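/- Let $\mathbb T=\mathbb R/2\pi\mathbb Z$ with Lebesgue measure $dx$ (total mass $2\pi$), let $\|u\|_{L^2}^2=\int_{\mathbb T}|u|^2\,dx$ and $\hat u(n)=\frac1{2\pi}\int_{\mathbb T}e^{-inx}u(x)\,dx$ for complex-valued $u\in L^2(\mathbb T)$. For $t\in\mathbb R$ let $T_t$ be the operator on $L^2(\mathbb T)$ with $\widehat{T_tu}(n)=e^{-in^2t}\,\hat u(n)$ for all $n\in\mathbb Z$. For $B>0$ put $$W_B(u)=\int_0^B\int_{\mathbb T}|T_tu(x)|^4\,dx\,dt,\qquad J_{B,1}=\sup\{W_B(u):u\in L^2(\mathbb T),\ \|u\|_{L^2}^2=1\}.$$ Then there is a number $B_4=2.60\pm0.01$ (that is, $|B_4-2.60|\le 0.01$) such that for every $B$ with $0<B<B_4$ the supremum $J_{B,1}$ is finite and is attained: there exists $u_0\in L^2(\mathbb T)$ with $\|u_0\|_{L^2}^2=1$ and $W_B(u_0)=J_{B,1}$. -/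

import Mathlib

open MeasureTheory
open scoped ENNReal

noncomputable section

namespace TorusStrichartz

instance factTwoPiPos : Fact (0 < 2 * Real.pi) := ⟨Real.two_pi_pos⟩

/-- The torus `ℝ / 2πℤ`. Its measure `volume` is Lebesgue measure, of total mass `2π`. -/
abbrev Torus : Type := AddCircle (2 * Real.pi)

/-- Complex `L²` functions on the torus, with respect to Lebesgue measure (total mass `2π`). -/
abbrev L2T : Type := Lp ℂ 2 (volume : Measure Torus)

/-- The same function, regarded as an element of `L²` for normalized Haar measure `dx / 2π`. -/
def toHaar (u : L2T) : Lp ℂ 2 (AddCircle.haarAddCircle : Measure Torus) :=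
  (memLp_haarAddCircle_iff.2 (Lp.memLp u)).toLp u

/-- The same function, regarded as an element of `L²` for Lebesgue measure `dx`. -/
def ofHaar (v : Lp ℂ 2 (AddCircle.haarAddCircle : Measure Torus)) : L2T :=
  (memLp_haarAddCircle_iff.1 (Lp.memLp v)).toLp v

/-- The Fourier multiplier `e^{-i n² t}` of the linear Schrödinger equation. -/
def symbol (t : ℝ) (n : ℤ) : ℂ := Complex.exp (-Complex.I * (n : ℂ) ^ 2 * (t : ℂ))

lemma norm_symbol (t : ℝ) (n : ℤ) : ‖symbol t n‖ = 1 := by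
  have h : -Complex.I * (n : ℂ) ^ 2 * (t : ℂ) = ((-((n : ℝ) ^ 2 * t) : ℝ) : ℂ) * Complex.I := by
    push_cast
    ring
  rw [symbol, h, Complex.norm_exp_ofReal_mul_I]

lemma memlp_symbol_mul (t : ℝ) (a : lp (fun _ : ℤ => ℂ) 2) :
    Memℓp (fun n : ℤ => symbol t n * a n) 2 := by
  have h := lp.memℓp a
  rw [memℓp_gen_iff (by norm_num)] at h ⊢
  simpa [norm_symbol] using h

/-- Multiplication of a square-summable sequence by the multiplier `e^{-i n² t}`. -/
def multiplier (t : ℝ) (a : lp (fun _ : ℤ => ℂ) 2) : lp (fun _ : ℤ => ℂ) 2 :=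
  ⟨fun n : ℤ => symbol t n * a n, memlp_symbol_mul t a⟩

/-- The Schrödinger propagator `T_t` on `L²(𝕋)`: the Fourier multiplier operator with
`(T_t u)^(n) = e^{-i n² t} û(n)` (see `fourierCoeff_propagator`). -/
def propagator (t : ℝ) (u : L2T) : L2T :=
  ofHaar (fourierBasis.repr.symm (multiplier t (fourierBasis.repr (toHaar u))))

lemma ae_haar_of_ae_volume {p : Torus → Prop} (h : ∀ᵐ x ∂(volume : Measure Torus), p x) :
    ∀ᵐ x ∂(AddCircle.haarAddCircle : Measure Torus), p x := by
  rw [AddCircle.volume_eq_smul_haarAddCircle,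
    Measure.ae_ennreal_smul_measure_iff (by simp [Real.pi_pos])] at h
  exact h

lemma fourierCoeff_toHaar (u : L2T) : fourierCoeff (toHaar u) = fourierCoeff u :=
  fourierCoeff_congr_ae (MemLp.coeFn_toLp _)

lemma fourierCoeff_ofHaar (v : Lp ℂ 2 (AddCircle.haarAddCircle : Measure Torus)) :
    fourierCoeff (ofHaar v) = fourierCoeff v :=
  fourierCoeff_congr_ae (ae_haar_of_ae_volume (MemLp.coeFn_toLp _))

/-- The defining property of the propagator. Here `fourierCoeff u n` is
`(1 / 2π) ∫ e^{-inx} u(x) dx`. -/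
theorem fourierCoeff_propagator (t : ℝ) (u : L2T) (n : ℤ) :
    fourierCoeff (propagator t u) n =
      Complex.exp (-Complex.I * (n : ℂ) ^ 2 * (t : ℂ)) * fourierCoeff u n := by
  rw [propagator, fourierCoeff_ofHaar, ← fourierBasis_repr, LinearIsometryEquiv.apply_symm_apply]
  change symbol t n * fourierBasis.repr (toHaar u) n = _
  rw [fourierBasis_repr, fourierCoeff_toHaar, symbol]

/-- `W_B(u) = ∫₀^B ∫_𝕋 |T_t u(x)|⁴ dx dt`, as an extended nonnegative number. -/
def W (B : ℝ) (u : L2T) : ℝ≥0∞ :=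
  ∫⁻ t in Set.Icc 0 B, ∫⁻ x : Torus, ‖propagator t u x‖ₑ ^ 4

/-- `J_{B,λ} = sup {W_B(u) : u ∈ L²(𝕋), ‖u‖² = λ}`, as an extended nonnegative number. -/
def J (B lam : ℝ) : ℝ≥0∞ :=
  sSup {w : ℝ≥0∞ | ∃ u : L2T, ‖u‖ ^ 2 = lam ∧ W B u = w}

/-- `u` is a maximizer for `J_{B,λ}`. -/
def IsMaximizer (B lam : ℝ) (u : L2T) : Prop :=
  ‖u‖ ^ 2 = lam ∧ W B u = J B lam

end TorusStrichartz

end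

/-! Write `a` for the Fourier coefficients of `u`. Parseval for `|T_t u|²` turns the inner integral
into a sum of squared correlations of `a`. Since `n² - (n+j)² - (n+k)² + (n+j+k)² = 2jk`,
integrating in time makes `W_B(u)` a quartic form with coefficients `∫₀^B e^{2ijkt} dt`. The
resonant terms `jk = 0` contribute `2B (∑|a_n|²)² - B ∑|a_n|⁴`; the first summand is constant on the
sphere. What remains (`W_eq`) is a form `G` with coefficients `coeff B`. These are `O(1/|jk|)` off
the axes and hence square summable, so `G` is bounded on `ℓ²` by Cauchy-Schwarz.

A form with square summable coefficients is a uniform limit of finite ones, so it behaves almost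
like a compact functional modulo translations of `ℤ`. If `M = sup G > 0` on the unit sphere, a
maximizing sequence cannot vanish. After translation it has a nonzero weak limit `a` of mass `θ`.
Brezis-Lieb splitting and homogeneity give `M ≤ M θ² + M (1-θ)²`, which forces `θ = 1` and makes `a`
a maximizer (`exists_maximizer_quartic`).

It remains to find `a` with `G(a) > 0`. The test sequences are `e^{iδn²}` on `[0, N)`, which refocus
at time `δ`. Averaging over `δ ∈ [0, η]`, dividing by `N` and letting `N → ∞` leaves the condition
`B η < ∑ kernel B η (jk)` (`exists_quartic_pos_of_lt_tsum_kernel`). Each row of this double cosine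
series is a combination of values of the periodized Bernoulli polynomial `B₂`. The choice `η = B/2`
works for `B < 2π/3` and `η = π - B` for `π/2 ≤ B < 5π/6`; finally `5π/6 > 2.6`. -/

noncomputable section

namespace TorusStrichartz

open AddCircle Filter Topology ComplexConjugate

/-! ### Fourier coefficients of integrable functions -/

section Uniqueness

variable {T : ℝ} [hT : Fact (0 < T)]

lemma integrable_continuousMap_mul {h : AddCircle T → ℂ} (hh : Integrable h haarAddCircle)
    (g : C(AddCircle T, ℂ)) : Integrable (fun x => g x * h x) haarAddCircle :=
  hh.bdd_mul g.continuous.aestronglyMeasurable (ae_of_all _ g.norm_coe_le_norm)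

/-- Pairing with an integrable `h` is continuous in the sup norm and vanishes on characters, whose
span is dense. -/
lemma integral_continuousMap_mul_eq_zero {h : AddCircle T → ℂ} (hh : Integrable h haarAddCircle)
    (h0 : ∀ n, fourierCoeff h n = 0) (g : C(AddCircle T, ℂ)) :
    ∫ x, g x * h x ∂haarAddCircle = 0 := by
  let Λ : C(AddCircle T, ℂ) →ₗ[ℂ] ℂ :=
    { toFun := fun g => ∫ x, g x * h x ∂haarAddCircle
      map_add' := fun f g => by
        rw [← integral_add (integrable_continuousMap_mul hh f) (integrable_continuousMap_mul hh g)]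
        simp [add_mul]
      map_smul' := fun c g => by
        simp [mul_assoc, integral_const_mul] }
  let L := Λ.mkContinuous (∫ x, ‖h x‖ ∂haarAddCircle) fun g => by
    calc ‖∫ x, g x * h x ∂haarAddCircle‖ ≤ ∫ x, ‖g x * h x‖ ∂haarAddCircle :=
          norm_integral_le_integral_norm _
      _ ≤ ∫ x, ‖g‖ * ‖h x‖ ∂haarAddCircle := by
          refine integral_mono (integrable_continuousMap_mul hh g).norm (hh.norm.const_mul _) ?_
          intro x
          simp only [norm_mul]
          gcongr
          exact g.norm_coe_le_norm x
      _ = (∫ x, ‖h x‖ ∂haarAddCircle) * ‖g‖ := by rw [integral_const_mul, mul_comm]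
  have hker : (⊤ : Submodule ℂ C(AddCircle T, ℂ)) ≤ LinearMap.ker (L : C(AddCircle T, ℂ) →ₗ[ℂ] ℂ) := by
    rw [← span_fourier_closure_eq_top]
    refine Submodule.topologicalClosure_minimal _ ?_ L.isClosed_ker
    rw [Submodule.span_le]
    rintro _ ⟨n, rfl⟩
    have := h0 (-n)
    simp only [fourierCoeff, neg_neg, smul_eq_mul] at this
    exact this
  exact hker (Submodule.mem_top (x := g))

/-- Indicators of closed sets are bounded pointwise limits of continuous functions, so all integrals
of `h` over closed sets vanish. -/
lemma ae_eq_zero_of_fourierCoeff_eq_zero {h : AddCircle T → ℂ} (hh : Integrable h haarAddCircle)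
    (h0 : ∀ n, fourierCoeff h n = 0) : h =ᵐ[haarAddCircle] 0 := by
  refine ae_eq_zero_of_forall_setIntegral_isClosed_eq_zero hh fun s hs => ?_
  have hδ : ∀ n : ℕ, (0 : ℝ) < 1 / ((n : ℝ) + 1) := fun n => Nat.one_div_pos_of_nat
  let g : ℕ → C(AddCircle T, ℂ) := fun n =>
    ⟨fun x => ((thickenedIndicator (hδ n) s x : ℝ) : ℂ), by fun_prop⟩
  have hlim := thickenedIndicator_tendsto_indicator_closure hδ tendsto_one_div_add_atTop_nhds_zero_nat s
  rw [hs.closure_eq, tendsto_pi_nhds] at hlim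
  have key : Tendsto (fun n => ∫ x, g n x * h x ∂haarAddCircle) atTop
      (𝓝 (∫ x, s.indicator h x ∂haarAddCircle)) := by
    refine tendsto_integral_of_dominated_convergence (fun x => ‖h x‖)
      (fun n => (integrable_continuousMap_mul hh (g n)).aestronglyMeasurable) hh.norm
      (fun n => ae_of_all _ fun x => ?_) (ae_of_all _ fun x => ?_)
    · rw [norm_mul]
      refine mul_le_of_le_one_left (norm_nonneg _) ?_
      change ‖((thickenedIndicator (hδ n) s x : ℝ) : ℂ)‖ ≤ 1
      rw [Complex.norm_real, Real.norm_of_nonneg (NNReal.coe_nonneg _)]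
      exact_mod_cast thickenedIndicator_le_one (hδ n) s x
    · have h1 : Tendsto (fun n => g n x) atTop
          (𝓝 (((s.indicator (fun _ => (1 : NNReal)) x : NNReal) : ℝ) : ℂ)) :=
        (Complex.continuous_ofReal.tendsto _).comp ((NNReal.continuous_coe.tendsto _).comp (hlim x))
      convert h1.mul_const (h x) using 2
      by_cases hx : x ∈ s <;> simp [hx]
  simp_rw [integral_continuousMap_mul_eq_zero hh h0] at key
  rw [← integral_indicator hs.measurableSet]
  exact (tendsto_nhds_unique key tendsto_const_nhds)

lemma lintegral_enorm_sq_eq_ofReal {f : AddCircle T → ℂ} (hf : MemLp f 2 haarAddCircle) :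
    ∫⁻ x, ‖f x‖ₑ ^ 2 ∂haarAddCircle = ENNReal.ofReal (∫ x, ‖f x‖ ^ 2 ∂haarAddCircle) := by
  rw [ofReal_integral_eq_lintegral_ofReal hf.norm.integrable_sq (ae_of_all _ fun x => by positivity)]
  refine lintegral_congr fun x => ?_
  rw [ENNReal.ofReal_pow (norm_nonneg _), ofReal_norm]

/-- Parseval's identity in `[0, ∞]`, for integrable functions. -/
lemma lintegral_enorm_sq_eq_tsum {h : AddCircle T → ℂ} (hh : Integrable h haarAddCircle) :
    ∫⁻ x, ‖h x‖ₑ ^ 2 ∂haarAddCircle = ∑' n, ‖fourierCoeff h n‖ₑ ^ 2 := by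
  have hL2 : MemLp h 2 haarAddCircle →
      ∫⁻ x, ‖h x‖ₑ ^ 2 ∂haarAddCircle = ∑' n, ‖fourierCoeff h n‖ₑ ^ 2 := by
    intro hm
    have hs := hasSum_sq_fourierCoeff (hm.toLp h)
    rw [fourierCoeff_congr_ae hm.coeFn_toLp] at hs
    rw [lintegral_enorm_sq_eq_ofReal hm]
    have h1 : ∫ x, ‖h x‖ ^ 2 ∂haarAddCircle = ∫ x, ‖hm.toLp h x‖ ^ 2 ∂haarAddCircle := by
      refine integral_congr_ae ?_
      filter_upwards [hm.coeFn_toLp] with x hx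
      rw [hx]
    rw [h1, ← hs.tsum_eq, ENNReal.ofReal_tsum_of_nonneg (fun n => by positivity) hs.summable]
    refine tsum_congr fun n => ?_
    rw [ENNReal.ofReal_pow (norm_nonneg _), ofReal_norm]
  by_cases hm : MemLp h 2 haarAddCircle
  · exact hL2 hm
  -- If the coefficients were square summable, Riesz-Fischer would give an `L²` function with the
  -- same coefficients, equal to `h` by uniqueness in `L¹`.
  have htop : ∑' n, ‖fourierCoeff h n‖ₑ ^ 2 = ⊤ := by
    by_contra hne
    apply hm
    have hmem : Memℓp (fun n : ℤ => fourierCoeff h n) 2 := by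
      rw [memℓp_gen_iff (by norm_num)]
      have := ENNReal.summable_toReal hne
      simpa using this
    let a : lp (fun _ : ℤ => ℂ) 2 := ⟨fun n => fourierCoeff h n, hmem⟩
    let g := (fourierBasis (T := T)).repr.symm a
    have hg : ∀ n, fourierCoeff g n = fourierCoeff h n := by
      intro n
      rw [← fourierBasis_repr, LinearIsometryEquiv.apply_symm_apply]
    have hgL : MemLp g 2 haarAddCircle := Lp.memLp g
    have hgi : Integrable g haarAddCircle := hgL.integrable (by norm_num)
    have hz : (fun x => h x - g x) =ᵐ[haarAddCircle] 0 := by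
      refine ae_eq_zero_of_fourierCoeff_eq_zero (hh.sub hgi) fun n => ?_
      have := hg n
      simp only [fourierCoeff, smul_eq_mul] at this ⊢
      simp_rw [mul_sub]
      rw [integral_sub, this, sub_self]
      · simpa using hh.fourier_smul (-n)
      · simpa using hgi.fourier_smul (-n)
    refine hgL.ae_eq ?_
    filter_upwards [hz] with x hx
    exact (sub_eq_zero.1 hx).symm
  rw [htop]
  by_contra hne
  apply hm
  refine ⟨hh.aestronglyMeasurable, ?_⟩
  rw [eLpNorm_lt_top_iff_lintegral_rpow_enorm_lt_top (by norm_num) (by norm_num)]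
  simpa using lt_top_iff_ne_top.2 hne

/-- The Fourier coefficients of `|f|²`. -/
lemma fourierCoeff_normSq {f : AddCircle T → ℂ} (hf : MemLp f 2 haarAddCircle) (m : ℤ) :
    fourierCoeff (fun x => ((‖f x‖ ^ 2 : ℝ) : ℂ)) m =
      ∑' n, conj (fourierCoeff f n) * fourierCoeff f (n + m) := by
  -- Multiplication by `e^{-imx}` shifts the coefficients by `m`, so the claim is Parseval for the
  -- pair `f`, `e^{-imx} f`.
  have hfm : MemLp (fun x => fourier (-m) x * f x) 2 haarAddCircle := by
    refine hf.of_le ((map_continuous (fourier (-m))).aestronglyMeasurable.mul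
      hf.aestronglyMeasurable) (ae_of_all _ fun x => ?_)
    simp [Circle.norm_coe]
  have h1 := (fourierBasis (T := T)).tsum_inner_mul_inner (hf.toLp f) (hfm.toLp _)
  have hb : ∀ n (v : Lp ℂ 2 (haarAddCircle : Measure (AddCircle T))),
      inner ℂ (fourierBasis n) v = fourierCoeff v n := by
    intro n v
    rw [← fourierBasis_repr, HilbertBasis.repr_apply_apply]
  have hb' : ∀ n (v : Lp ℂ 2 (haarAddCircle : Measure (AddCircle T))),
      inner ℂ v (fourierBasis n) = conj (fourierCoeff v n) := by
    intro n v
    rw [← hb, inner_conj_symm]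
  simp_rw [hb, hb', fourierCoeff_congr_ae hf.coeFn_toLp, fourierCoeff_congr_ae hfm.coeFn_toLp] at h1
  have h2 : ∀ n, fourierCoeff (fun x => fourier (-m) x * f x) n = fourierCoeff f (n + m) := by
    intro n
    unfold fourierCoeff
    refine integral_congr_ae (ae_of_all _ fun x => ?_)
    simp only [smul_eq_mul]
    rw [neg_add, fourier_add, mul_assoc]
  simp_rw [h2] at h1
  rw [h1, L2.inner_def]
  unfold fourierCoeff
  refine integral_congr_ae ?_
  filter_upwards [hf.coeFn_toLp, hfm.coeFn_toLp] with x hx hx'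
  rw [hx, hx', RCLike.inner_apply, smul_eq_mul, mul_assoc, Complex.mul_conj, Complex.normSq_eq_norm_sq]

end Uniqueness

/-- The `L⁴` norm of a square integrable function, in terms of its Fourier coefficients. -/
lemma lintegral_enorm_pow_four {f : Torus → ℂ}
    (hf : MemLp f 2 (haarAddCircle : Measure Torus)) :
    ∫⁻ x, ‖f x‖ₑ ^ 4 = ENNReal.ofReal (2 * Real.pi) *
      ∑' m : ℤ, ‖∑' n : ℤ, conj (fourierCoeff f n) * fourierCoeff f (n + m)‖ₑ ^ 2 := by
  have hi : Integrable (fun x => ((‖f x‖ ^ 2 : ℝ) : ℂ)) (haarAddCircle : Measure Torus) :=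
    hf.norm.integrable_sq.ofReal
  have := lintegral_enorm_sq_eq_tsum hi
  simp_rw [fourierCoeff_normSq hf] at this
  rw [volume_eq_smul_haarAddCircle, lintegral_smul_measure, ← this, smul_eq_mul]
  congr 1
  refine lintegral_congr fun x => ?_
  rw [← ofReal_norm, ← ofReal_norm, Complex.norm_real, Real.norm_of_nonneg (by positivity),
    ← ENNReal.ofReal_pow (by positivity), ← ENNReal.ofReal_pow (by positivity)]
  ring_nf

/-! ### Quartic forms on `ℓ²(ℤ)` -/

lemma summable_mul_and_tsum_mul_le_sqrt {ι : Type*} {f g : ι → ℝ} (hf : ∀ i, 0 ≤ f i)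
    (hg : ∀ i, 0 ≤ g i) (hf2 : Summable fun i => f i ^ 2) (hg2 : Summable fun i => g i ^ 2) :
    (Summable fun i => f i * g i) ∧
      ∑' i, f i * g i ≤ √(∑' i, f i ^ 2) * √(∑' i, g i ^ 2) := by
  have := Real.summable_and_inner_le_Lp_mul_Lq_tsum_of_nonneg Real.HolderConjugate.two_two hf hg
    (by simpa using hf2) (by simpa using hg2)
  simpa [Real.sqrt_eq_rpow] using this

lemma exists_finset_tsum_indicator_compl_lt {ι : Type*} {f : ι → ℝ} {ε : ℝ}
    (hε : 0 < ε) : ∃ F : Finset ι, ∑' i, (↑F : Set ι)ᶜ.indicator f i < ε := by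
  have h := tendsto_tsum_compl_atTop_zero f
  obtain ⟨F, hF⟩ := (h.eventually_lt_const hε).exists
  refine ⟨F, ?_⟩
  rw [← tsum_subtype]
  exact hF

/-- The square of the `ℓ²` norm of a sequence. -/
def mass (a : ℤ → ℂ) : ℝ := ∑' n, ‖a n‖ ^ 2

/-- Membership in `ℓ²(ℤ)`. -/
def SqSummable (a : ℤ → ℂ) : Prop := Summable fun n => ‖a n‖ ^ 2

lemma mass_nonneg (a : ℤ → ℂ) : 0 ≤ mass a := tsum_nonneg fun _ => by positivity

lemma SqSummable.norm_sq_le_mass {a : ℤ → ℂ} (ha : SqSummable a) (n : ℤ) : ‖a n‖ ^ 2 ≤ mass a :=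
  Summable.le_tsum ha n fun _ _ => by positivity

lemma SqSummable.norm_le {a : ℤ → ℂ} (ha : SqSummable a) (n : ℤ) : ‖a n‖ ≤ √(mass a) :=
  Real.le_sqrt_of_sq_le (ha.norm_sq_le_mass n)

lemma SqSummable.comp_add {a : ℤ → ℂ} (ha : SqSummable a) (s : ℤ) :
    SqSummable fun n => a (n + s) := by
  have := Summable.comp_injective ha (add_left_injective s)
  simpa only [SqSummable, Function.comp_def] using this

lemma mass_comp_add (a : ℤ → ℂ) (s : ℤ) : mass (fun n => a (n + s)) = mass a := by
  have := (Equiv.addRight s).tsum_eq fun n => ‖a n‖ ^ 2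
  simpa only [mass, Equiv.coe_addRight] using this

lemma SqSummable.add {a b : ℤ → ℂ} (ha : SqSummable a) (hb : SqSummable b) :
    SqSummable (a + b) := by
  refine Summable.of_nonneg_of_le (fun n => by positivity) (fun n => ?_)
    ((Summable.mul_left 2 ha).add (Summable.mul_left 2 hb))
  have := norm_add_le (a n) (b n)
  simp only [Pi.add_apply]
  nlinarith [norm_nonneg (a n + b n), sq_nonneg (‖a n‖ - ‖b n‖), norm_nonneg (a n), norm_nonneg (b n)]

lemma SqSummable.neg {a : ℤ → ℂ} (ha : SqSummable a) : SqSummable (-a) := by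
  simpa [SqSummable] using ha

lemma SqSummable.sub {a b : ℤ → ℂ} (ha : SqSummable a) (hb : SqSummable b) :
    SqSummable (a - b) := by
  rw [sub_eq_add_neg]; exact ha.add hb.neg

lemma SqSummable.smul {a : ℤ → ℂ} (ha : SqSummable a) (r : ℂ) : SqSummable (r • a) := by
  simpa [SqSummable, mul_pow] using Summable.mul_left (‖r‖ ^ 2) ha

lemma mass_smul (r : ℂ) (a : ℤ → ℂ) : mass (r • a) = ‖r‖ ^ 2 * mass a := by
  simp [mass, mul_pow, tsum_mul_left]

lemma mass_add_le {a b : ℤ → ℂ} (ha : SqSummable a) (hb : SqSummable b) :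
    mass (a + b) ≤ 2 * mass a + 2 * mass b := by
  unfold mass
  rw [← tsum_mul_left, ← tsum_mul_left, ← Summable.tsum_add (Summable.mul_left 2 ha)
    (Summable.mul_left 2 hb)]
  refine Summable.tsum_le_tsum (fun n => ?_) (ha.add hb)
    ((Summable.mul_left 2 ha).add (Summable.mul_left 2 hb))
  have := norm_add_le (a n) (b n)
  simp only [Pi.add_apply]
  nlinarith [norm_nonneg (a n + b n), sq_nonneg (‖a n‖ - ‖b n‖), norm_nonneg (a n), norm_nonneg (b n)]

lemma SqSummable.summable_norm_mul {a b : ℤ → ℂ} (ha : SqSummable a) (hb : SqSummable b) :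
    Summable fun n => ‖a n‖ * ‖b n‖ :=
  (summable_mul_and_tsum_mul_le_sqrt (fun _ => norm_nonneg _) (fun _ => norm_nonneg _) ha hb).1

lemma SqSummable.tsum_norm_mul_le {a b : ℤ → ℂ} (ha : SqSummable a) (hb : SqSummable b) :
    ∑' n, ‖a n‖ * ‖b n‖ ≤ √(mass a) * √(mass b) :=
  (summable_mul_and_tsum_mul_le_sqrt (fun _ => norm_nonneg _) (fun _ => norm_nonneg _) ha hb).2

/-- The product `conj a_n a_{n+j} a_{n+k} conj a_{n+j+k}`. -/
def quad (a : ℤ → ℂ) (p : ℤ × ℤ) (n : ℤ) : ℂ :=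
  conj (a n) * a (n + p.1) * a (n + p.2) * conj (a (n + p.1 + p.2))

/-- The quartic form `∑ c(j, k) conj a_n a_{n+j} a_{n+k} conj a_{n+j+k}`. -/
def quartic (c : ℤ × ℤ → ℂ) (a : ℤ → ℂ) : ℂ := ∑' q : (ℤ × ℤ) × ℤ, c q.1 * quad a q.1 q.2

lemma norm_quad (a : ℤ → ℂ) (p : ℤ × ℤ) (n : ℤ) :
    ‖quad a p n‖ = ‖a n‖ * (‖a (n + p.1)‖ * ‖a (n + p.2)‖ * ‖a (n + p.1 + p.2)‖) := by
  simp only [quad, norm_mul, RCLike.norm_conj]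
  ring

lemma summable_triple_and_tsum_eq {f : ℤ → ℝ} (hf : Summable f) (hf0 : ∀ n, 0 ≤ f n) :
    (Summable fun t : ℤ × ℤ × ℤ => f t.1 * (f t.2.1 * f t.2.2)) ∧
      ∑' t : ℤ × ℤ × ℤ, f t.1 * (f t.2.1 * f t.2.2) = (∑' n, f n) ^ 3 := by
  have h2 : Summable fun t : ℤ × ℤ => f t.1 * f t.2 := Summable.mul_of_nonneg hf hf hf0 hf0
  have h3 : Summable fun t : ℤ × ℤ × ℤ => f t.1 * (f t.2.1 * f t.2.2) := by
    have := Summable.mul_of_nonneg hf h2 hf0 fun t => mul_nonneg (hf0 _) (hf0 _)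
    simpa only using this
  refine ⟨h3, ?_⟩
  have e2 := Summable.tsum_mul_tsum hf hf h2
  have e3 := Summable.tsum_mul_tsum hf h2 (by simpa only using h3)
  rw [← e3, ← e2]
  ring

/-- Three corners of the parallelogram determine `n`, `j` and `k`, so this is a subsum of the triple
product of masses. -/
lemma summable_corner_and_tsum_le {a : ℤ → ℂ} (ha : SqSummable a) :
    (Summable fun q : (ℤ × ℤ) × ℤ =>
      (‖a (q.2 + q.1.1)‖ * ‖a (q.2 + q.1.2)‖ * ‖a (q.2 + q.1.1 + q.1.2)‖) ^ 2) ∧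
    ∑' q : (ℤ × ℤ) × ℤ,
      (‖a (q.2 + q.1.1)‖ * ‖a (q.2 + q.1.2)‖ * ‖a (q.2 + q.1.1 + q.1.2)‖) ^ 2 ≤ mass a ^ 3 := by
  obtain ⟨hT, hTt⟩ := summable_triple_and_tsum_eq (f := fun n => ‖a n‖ ^ 2) ha
    (fun n => by positivity)
  let e : (ℤ × ℤ) × ℤ → ℤ × ℤ × ℤ := fun q => (q.2 + q.1.1, q.2 + q.1.2, q.2 + q.1.1 + q.1.2)
  have he : Function.Injective e := by
    rintro ⟨⟨j, k⟩, n⟩ ⟨⟨j', k'⟩, n'⟩ h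
    simp only [e, Prod.mk.injEq] at h ⊢
    omega
  have hg : (fun q : (ℤ × ℤ) × ℤ =>
      (‖a (q.2 + q.1.1)‖ * ‖a (q.2 + q.1.2)‖ * ‖a (q.2 + q.1.1 + q.1.2)‖) ^ 2) =
      (fun t : ℤ × ℤ × ℤ => ‖a t.1‖ ^ 2 * (‖a t.2.1‖ ^ 2 * ‖a t.2.2‖ ^ 2)) ∘ e := by
    ext q
    simp only [e, Function.comp, mul_pow, mul_assoc]
  rw [hg]
  refine ⟨hT.comp_injective he, ?_⟩
  rw [mass, ← hTt]
  exact tsum_comp_le_tsum_of_inj hT (fun t => by positivity) he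

/-- Cauchy-Schwarz with `c(j,k) a_n` on one side and the three other factors on the other. -/
lemma summable_quartic_and_norm_le {c : ℤ × ℤ → ℂ} {a : ℤ → ℂ} (hc : Summable fun p => ‖c p‖ ^ 2)
    (ha : SqSummable a) :
    (Summable fun q : (ℤ × ℤ) × ℤ => ‖c q.1 * quad a q.1 q.2‖) ∧
      ‖quartic c a‖ ≤ √(∑' p, ‖c p‖ ^ 2) * mass a ^ 2 := by
  have h1s : Summable fun q : (ℤ × ℤ) × ℤ => ‖c q.1‖ ^ 2 * ‖a q.2‖ ^ 2 :=
    Summable.mul_of_nonneg (f := fun p => ‖c p‖ ^ 2) (g := fun n => ‖a n‖ ^ 2) hc ha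
      (fun _ => sq_nonneg _) (fun _ => sq_nonneg _)
  have h1 : Summable fun q : (ℤ × ℤ) × ℤ => (‖c q.1‖ * ‖a q.2‖) ^ 2 := by
    simpa only [mul_pow] using h1s
  have h1t : ∑' q : (ℤ × ℤ) × ℤ, (‖c q.1‖ * ‖a q.2‖) ^ 2 = (∑' p, ‖c p‖ ^ 2) * mass a := by
    rw [mass, Summable.tsum_mul_tsum hc ha h1s]
    simp only [mul_pow]
  obtain ⟨hgs, hgt⟩ := summable_corner_and_tsum_le ha
  obtain ⟨hs, hle⟩ := summable_mul_and_tsum_mul_le_sqrt (fun _ => by positivity)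
    (fun _ => by positivity) h1 hgs
  have hEq : (fun q : (ℤ × ℤ) × ℤ => ‖c q.1 * quad a q.1 q.2‖) = fun q => ‖c q.1‖ * ‖a q.2‖ *
      (‖a (q.2 + q.1.1)‖ * ‖a (q.2 + q.1.2)‖ * ‖a (q.2 + q.1.1 + q.1.2)‖) := by
    ext q
    simp only [norm_mul, norm_quad, mul_assoc]
  rw [h1t] at hle
  have hs' : Summable fun q : (ℤ × ℤ) × ℤ => ‖c q.1 * quad a q.1 q.2‖ := by rw [hEq]; exact hs
  refine And.intro hs' ?_
  calc ‖quartic c a‖ ≤ ∑' q : (ℤ × ℤ) × ℤ, ‖c q.1 * quad a q.1 q.2‖ := by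
        rw [quartic]; exact norm_tsum_le_tsum_norm hs'
    _ ≤ √((∑' p, ‖c p‖ ^ 2) * mass a) * √(∑' q : (ℤ × ℤ) × ℤ,
          (‖a (q.2 + q.1.1)‖ * ‖a (q.2 + q.1.2)‖ * ‖a (q.2 + q.1.1 + q.1.2)‖) ^ 2) := by
        rw [hEq]; exact hle
    _ ≤ √((∑' p, ‖c p‖ ^ 2) * mass a) * √(mass a ^ 3) := by gcongr
    _ = √(∑' p, ‖c p‖ ^ 2) * mass a ^ 2 := by
        rw [Real.sqrt_mul (tsum_nonneg fun _ => by positivity), mul_assoc,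
          ← Real.sqrt_mul (mass_nonneg a), show mass a * mass a ^ 3 = (mass a ^ 2) ^ 2 by ring,
          Real.sqrt_sq (by positivity)]

lemma summable_quartic {c : ℤ × ℤ → ℂ} {a : ℤ → ℂ} (hc : Summable fun p => ‖c p‖ ^ 2)
    (ha : SqSummable a) : Summable fun q : (ℤ × ℤ) × ℤ => c q.1 * quad a q.1 q.2 :=
  (summable_quartic_and_norm_le hc ha).1.of_norm

lemma norm_quartic_le {c : ℤ × ℤ → ℂ} {a : ℤ → ℂ} (hc : Summable fun p => ‖c p‖ ^ 2)
    (ha : SqSummable a) : ‖quartic c a‖ ≤ √(∑' p, ‖c p‖ ^ 2) * mass a ^ 2 :=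
  (summable_quartic_and_norm_le hc ha).2

lemma quartic_eq_tsum {c : ℤ × ℤ → ℂ} {a : ℤ → ℂ} (hc : Summable fun p => ‖c p‖ ^ 2)
    (ha : SqSummable a) : quartic c a = ∑' p, c p * ∑' n, quad a p n := by
  rw [quartic, (summable_quartic hc ha).tsum_prod]
  simp [tsum_mul_left]

/-- This is the noncompact symmetry by which maximizing sequences are recentred. -/
lemma quartic_comp_add (c : ℤ × ℤ → ℂ) (a : ℤ → ℂ) (s : ℤ) :
    quartic c (fun n => a (n + s)) = quartic c a := by
  unfold quartic
  rw [← ((Equiv.refl (ℤ × ℤ)).prodCongr (Equiv.addRight s)).tsum_eq fun q => c q.1 * quad a q.1 q.2]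
  refine tsum_congr fun q => ?_
  simp only [quad, Equiv.prodCongr_apply, Equiv.coe_refl, Prod.map_fst, Prod.map_snd, id,
    Equiv.coe_addRight]
  ring_nf

lemma quartic_smul (c : ℤ × ℤ → ℂ) (a : ℤ → ℂ) (r : ℝ) :
    quartic c ((r : ℂ) • a) = (r : ℂ) ^ 4 * quartic c a := by
  unfold quartic
  rw [← tsum_mul_left]
  refine tsum_congr fun q => ?_
  simp only [quad, Pi.smul_apply, smul_eq_mul, map_mul, Complex.conj_ofReal]
  ring

/-- A quartic form with square summable coefficients is a limit of finite ones. -/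
lemma exists_finset_norm_quartic_sub_le {c : ℤ × ℤ → ℂ} (hc : Summable fun p => ‖c p‖ ^ 2)
    {ε : ℝ} (hε : 0 < ε) : ∃ F : Finset (ℤ × ℤ), ∀ a, SqSummable a →
      ‖quartic c a - ∑ p ∈ F, c p * ∑' n, quad a p n‖ ≤ ε * mass a ^ 2 := by
  classical
  obtain ⟨F, hF⟩ := exists_finset_tsum_indicator_compl_lt (f := fun p => ‖c p‖ ^ 2)
    (show 0 < ε ^ 2 by positivity)
  refine ⟨F, fun a ha => ?_⟩
  let c₁ := (↑F : Set (ℤ × ℤ)).indicator c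
  let c₂ := (↑F : Set (ℤ × ℤ))ᶜ.indicator c
  have e₁ : (fun p => ‖c₁ p‖ ^ 2) = (↑F : Set (ℤ × ℤ)).indicator fun p => ‖c p‖ ^ 2 := by
    ext p; by_cases hp : p ∈ F <;> simp [c₁, hp]
  have e₂ : (fun p => ‖c₂ p‖ ^ 2) = (↑F : Set (ℤ × ℤ))ᶜ.indicator fun p => ‖c p‖ ^ 2 := by
    ext p; by_cases hp : p ∈ F <;> simp [c₂, hp]
  have hc₁ : Summable fun p => ‖c₁ p‖ ^ 2 := by rw [e₁]; exact hc.indicator _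
  have hc₂ : Summable fun p => ‖c₂ p‖ ^ 2 := by rw [e₂]; exact hc.indicator _
  have hadd : quartic c a = quartic c₁ a + quartic c₂ a := by
    unfold quartic
    rw [← Summable.tsum_add (summable_quartic hc₁ ha) (summable_quartic hc₂ ha)]
    refine tsum_congr fun q => ?_
    rw [← add_mul]
    congr 1
    exact (congrFun (Set.indicator_self_add_compl (↑F : Set (ℤ × ℤ)) c) q.1).symm
  have h₁ : quartic c₁ a = ∑ p ∈ F, c p * ∑' n, quad a p n := by
    rw [quartic_eq_tsum hc₁ ha, tsum_eq_sum (s := F) (fun p hp => by simp [c₁, hp])]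
    refine Finset.sum_congr rfl fun p hp => ?_
    simp [c₁, hp]
  rw [hadd, h₁, add_sub_cancel_left]
  refine (norm_quartic_le hc₂ ha).trans ?_
  gcongr
  rw [e₂]
  exact Real.sqrt_le_iff.2 ⟨hε.le, hF.le⟩

/-! ### Weakly null sequences and the splitting of quartic forms -/

lemma tendsto_tsum_norm_mul {x : ℤ → ℂ} (hx : SqSummable x) {y : ℕ → ℤ → ℂ}
    (hy : ∀ m, SqSummable (y m)) {C : ℝ} (hC : ∀ m, mass (y m) ≤ C)
    (hlim : ∀ n, Tendsto (fun m => y m n) atTop (𝓝 0)) :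
    Tendsto (fun m => ∑' n, ‖x n‖ * ‖y m n‖) atTop (𝓝 0) := by
  classical
  have hnn : ∀ m, 0 ≤ ∑' n, ‖x n‖ * ‖y m n‖ := fun m => tsum_nonneg fun _ => by positivity
  rw [Metric.tendsto_atTop']
  intro ε hε
  set δ := ε / (2 * (√C + 1)) with hδ
  have hδ0 : 0 < δ := by positivity
  obtain ⟨F, hF⟩ := exists_finset_tsum_indicator_compl_lt (f := fun n => ‖x n‖ ^ 2)
    (show 0 < δ ^ 2 by positivity)
  let x₂ := (↑F : Set ℤ)ᶜ.indicator x
  have e₂ : (fun n => ‖x₂ n‖ ^ 2) = (↑F : Set ℤ)ᶜ.indicator fun n => ‖x n‖ ^ 2 := by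
    ext n; by_cases hn : n ∈ F <;> simp [x₂, hn]
  have hx₂ : SqSummable x₂ := by
    rw [SqSummable, e₂]; exact Summable.indicator hx _
  have hm₂ : √(mass x₂) ≤ δ := by
    rw [mass, e₂]; exact Real.sqrt_le_iff.2 ⟨hδ0.le, hF.le⟩
  have hsplit : ∀ m, ∑' n, ‖x n‖ * ‖y m n‖ ≤ ∑ n ∈ F, ‖x n‖ * ‖y m n‖ + δ * √C := by
    intro m
    have h1 : Summable ((↑F : Set ℤ).indicator fun n => ‖x n‖ * ‖y m n‖) :=
      (hx.summable_norm_mul (hy m)).indicator _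
    have h2 := hx₂.summable_norm_mul (hy m)
    have h3 : ∑' n, ‖x n‖ * ‖y m n‖ = ∑' n, (↑F : Set ℤ).indicator (fun n => ‖x n‖ * ‖y m n‖) n +
        ∑' n, ‖x₂ n‖ * ‖y m n‖ := by
      rw [← Summable.tsum_add h1 h2]
      refine tsum_congr fun n => ?_
      by_cases hn : n ∈ F <;> simp [x₂, hn]
    rw [h3, tsum_eq_sum (s := F) (fun n hn => by simp [hn])]
    refine add_le_add (le_of_eq (Finset.sum_congr rfl fun n hn => by simp [hn])) ?_
    refine (hx₂.tsum_norm_mul_le (hy m)).trans ?_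
    gcongr
    exact hC m
  have hfin : Tendsto (fun m => ∑ n ∈ F, ‖x n‖ * ‖y m n‖) atTop (𝓝 0) := by
    have : Tendsto (fun m => ∑ n ∈ F, ‖x n‖ * ‖y m n‖) atTop (𝓝 (∑ n ∈ F, ‖x n‖ * ‖(0 : ℂ)‖)) :=
      tendsto_finsetSum _ fun n _ => ((hlim n).norm.const_mul _)
    simpa using this
  obtain ⟨N, hN⟩ := (hfin.eventually_lt_const (half_pos hε)).exists_forall_of_atTop
  refine ⟨N, fun m hm => ?_⟩
  rw [Real.dist_eq, sub_zero, abs_of_nonneg (hnn m)]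
  have h4 : δ * √C < ε / 2 := by
    have : δ * (√C + 1) = ε / 2 := by rw [hδ]; field_simp
    linarith
  linarith [hsplit m, hN m hm.le]

/-- Each mixed term contains a factor `a` and a factor `b` at different corners. Keeping one such
pair and bounding the rest by `M` gives sums that vanish for weakly null `b`. -/
lemma norm_prod_four_add_sub_le {a₁ a₂ a₃ a₄ b₁ b₂ b₃ b₄ : ℂ} {M : ℝ}
    (ha₁ : ‖a₁‖ ≤ M) (ha₂ : ‖a₂‖ ≤ M) (ha₃ : ‖a₃‖ ≤ M) (ha₄ : ‖a₄‖ ≤ M)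
    (hb₁ : ‖b₁‖ ≤ M) (hb₂ : ‖b₂‖ ≤ M) (hb₃ : ‖b₃‖ ≤ M) (hb₄ : ‖b₄‖ ≤ M) :
    ‖(a₁ + b₁) * (a₂ + b₂) * (a₃ + b₃) * (a₄ + b₄) - a₁ * a₂ * a₃ * a₄ - b₁ * b₂ * b₃ * b₄‖ ≤
      4 * M ^ 2 * (‖a₁‖ * ‖b₃‖ + ‖a₃‖ * ‖b₁‖ + (‖a₁‖ * ‖b₂‖ + ‖a₂‖ * ‖b₁‖) +
        (‖a₃‖ * ‖b₄‖ + ‖a₄‖ * ‖b₃‖)) := by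
  have hM : 0 ≤ M := (norm_nonneg _).trans ha₁
  have e : (a₁ + b₁) * (a₂ + b₂) * (a₃ + b₃) * (a₄ + b₄) - a₁ * a₂ * a₃ * a₄ - b₁ * b₂ * b₃ * b₄ =
      a₁ * b₃ * (a₂ * b₄) + a₃ * b₁ * (a₄ * b₂) + (a₁ * b₂ + a₂ * b₁) * ((a₃ + b₃) * (a₄ + b₄)) +
        (a₃ * b₄ + a₄ * b₃) * (a₁ * a₂ + b₁ * b₂) := by ring
  have h1 : ‖a₁ * b₃ * (a₂ * b₄)‖ ≤ ‖a₁‖ * ‖b₃‖ * (M * M) := by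
    simp only [norm_mul]; gcongr
  have h2 : ‖a₃ * b₁ * (a₄ * b₂)‖ ≤ ‖a₃‖ * ‖b₁‖ * (M * M) := by
    simp only [norm_mul]; gcongr
  have h3 : ‖(a₁ * b₂ + a₂ * b₁) * ((a₃ + b₃) * (a₄ + b₄))‖ ≤
      (‖a₁‖ * ‖b₂‖ + ‖a₂‖ * ‖b₁‖) * ((M + M) * (M + M)) := by
    rw [norm_mul, norm_mul (a₃ + b₃)]
    gcongr
    · exact (norm_add_le _ _).trans (by simp only [norm_mul]; rfl)
    · exact (norm_add_le _ _).trans (add_le_add ha₃ hb₃)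
    · exact (norm_add_le _ _).trans (add_le_add ha₄ hb₄)
  have h4 : ‖(a₃ * b₄ + a₄ * b₃) * (a₁ * a₂ + b₁ * b₂)‖ ≤
      (‖a₃‖ * ‖b₄‖ + ‖a₄‖ * ‖b₃‖) * (M * M + M * M) := by
    rw [norm_mul]
    gcongr
    · exact (norm_add_le _ _).trans (by simp only [norm_mul]; rfl)
    · refine (norm_add_le _ _).trans ?_
      simp only [norm_mul]
      gcongr
  rw [e]
  refine (norm_add_le _ _).trans ?_
  refine (add_le_add ((norm_add_le _ _).trans (add_le_add ((norm_add_le _ _).trans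
    (add_le_add h1 h2)) h3)) h4).trans ?_
  have p1 : 0 ≤ ‖a₁‖ * ‖b₃‖ * (M * M) := by positivity
  have p2 : 0 ≤ ‖a₃‖ * ‖b₁‖ * (M * M) := by positivity
  have p3 : 0 ≤ (‖a₃‖ * ‖b₄‖ + ‖a₄‖ * ‖b₃‖) * (M * M) := by positivity
  nlinarith

lemma SqSummable.summable_quad {a : ℤ → ℂ} (ha : SqSummable a) (p : ℤ × ℤ) :
    Summable fun n => quad a p n := by
  refine Summable.of_norm_bounded ((ha.summable_norm_mul (ha.comp_add p.1)).mul_left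
    (√(mass a) * √(mass a))) fun n => ?_
  rw [norm_quad]
  have h1 := ha.norm_le (n + p.2)
  have h2 := ha.norm_le (n + p.1 + p.2)
  calc _ = (‖a (n + p.2)‖ * ‖a (n + p.1 + p.2)‖) * (‖a n‖ * ‖a (n + p.1)‖) := by ring
    _ ≤ _ := by gcongr

lemma tendsto_tsum_quad_add_sub {a : ℤ → ℂ} (ha : SqSummable a) {b : ℕ → ℤ → ℂ}
    (hb : ∀ m, SqSummable (b m)) {C : ℝ} (hC : ∀ m, mass (b m) ≤ C)
    (hlim : ∀ n, Tendsto (fun m => b m n) atTop (𝓝 0)) (p : ℤ × ℤ) :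
    Tendsto (fun m => ∑' n, quad (a + b m) p n - ∑' n, quad a p n - ∑' n, quad (b m) p n)
      atTop (𝓝 0) := by
  set M := √(max (mass a) C) with hM
  have haM : ∀ n, ‖a n‖ ≤ M := fun n => (ha.norm_le n).trans (Real.sqrt_le_sqrt (le_max_left _ _))
  have hbM : ∀ m n, ‖b m n‖ ≤ M := fun m n =>
    ((hb m).norm_le n).trans (Real.sqrt_le_sqrt ((hC m).trans (le_max_right _ _)))
  have hs : ∀ s t m, Summable fun n => ‖a (n + s)‖ * ‖b m (n + t)‖ := fun s t m =>
    (ha.comp_add s).summable_norm_mul ((hb m).comp_add t)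
  have ht : ∀ s t, Tendsto (fun m => ∑' n, ‖a (n + s)‖ * ‖b m (n + t)‖) atTop (𝓝 0) := fun s t =>
    tendsto_tsum_norm_mul (ha.comp_add s) (fun m => (hb m).comp_add t)
      (fun m => (mass_comp_add (b m) t).le.trans (hC m)) fun n => hlim (n + t)
  set j := p.1
  set k := p.2
  let R : ℕ → ℝ := fun m => 4 * M ^ 2 *
    (∑' n, ‖a (n + 0)‖ * ‖b m (n + k)‖ + ∑' n, ‖a (n + k)‖ * ‖b m (n + 0)‖ +
      (∑' n, ‖a (n + 0)‖ * ‖b m (n + j)‖ + ∑' n, ‖a (n + j)‖ * ‖b m (n + 0)‖) +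
      (∑' n, ‖a (n + k)‖ * ‖b m (n + (j + k))‖ + ∑' n, ‖a (n + (j + k))‖ * ‖b m (n + k)‖))
  have hR : Tendsto R atTop (𝓝 0) := by
    have := ((((ht 0 k).add (ht k 0)).add ((ht 0 j).add (ht j 0))).add
      ((ht k (j + k)).add (ht (j + k) k))).const_mul (4 * M ^ 2)
    rw [add_zero, add_zero, add_zero, mul_zero] at this
    exact this
  refine squeeze_zero_norm (fun m => ?_) hR
  rw [← Summable.tsum_sub ((ha.add (hb m)).summable_quad p) (ha.summable_quad p),
    ← Summable.tsum_sub (((ha.add (hb m)).summable_quad p).sub (ha.summable_quad p))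
      ((hb m).summable_quad p)]
  have hsum := (((((hs 0 k m).add (hs k 0 m)).add ((hs 0 j m).add (hs j 0 m))).add
      ((hs k (j + k) m).add (hs (j + k) k m))).mul_left (4 * M ^ 2))
  have hRm : R m = ∑' n, 4 * M ^ 2 * (‖a (n + 0)‖ * ‖b m (n + k)‖ + ‖a (n + k)‖ * ‖b m (n + 0)‖ +
      (‖a (n + 0)‖ * ‖b m (n + j)‖ + ‖a (n + j)‖ * ‖b m (n + 0)‖) +
      (‖a (n + k)‖ * ‖b m (n + (j + k))‖ + ‖a (n + (j + k))‖ * ‖b m (n + k)‖)) := by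
    rw [tsum_mul_left, Summable.tsum_add (((hs 0 k m).add (hs k 0 m)).add ((hs 0 j m).add (hs j 0 m)))
      ((hs k (j + k) m).add (hs (j + k) k m)), Summable.tsum_add ((hs 0 k m).add (hs k 0 m))
      ((hs 0 j m).add (hs j 0 m)), Summable.tsum_add (hs 0 k m) (hs k 0 m),
      Summable.tsum_add (hs 0 j m) (hs j 0 m),
      Summable.tsum_add (hs k (j + k) m) (hs (j + k) k m)]
  rw [hRm]
  refine tsum_of_norm_bounded hsum.hasSum fun n => ?_
  have hc : ∀ z : ℂ, ‖conj z‖ = ‖z‖ := RCLike.norm_conj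
  have := norm_prod_four_add_sub_le (M := M) (a₁ := conj (a n)) (a₂ := a (n + j)) (a₃ := a (n + k))
    (a₄ := conj (a (n + j + k))) (b₁ := conj (b m n)) (b₂ := b m (n + j)) (b₃ := b m (n + k))
    (b₄ := conj (b m (n + j + k))) (by simpa [hc] using haM n) (haM _) (haM _)
    (by simpa [hc] using haM (n + j + k)) (by simpa [hc] using hbM m n) (hbM m _) (hbM m _)
    (by simpa [hc] using hbM m (n + j + k))
  simp only [hc] at this
  simpa only [quad, Pi.add_apply, map_add, add_zero, add_assoc] using this

/-- The Brezis-Lieb splitting of a quartic form along a weakly null sequence. -/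
lemma tendsto_quartic_add_sub {c : ℤ × ℤ → ℂ} (hc : Summable fun p => ‖c p‖ ^ 2)
    {a : ℤ → ℂ} (ha : SqSummable a) {b : ℕ → ℤ → ℂ}
    (hb : ∀ m, SqSummable (b m)) {C : ℝ} (hC : ∀ m, mass (b m) ≤ C)
    (hlim : ∀ n, Tendsto (fun m => b m n) atTop (𝓝 0)) :
    Tendsto (fun m => quartic c (a + b m) - quartic c a - quartic c (b m)) atTop (𝓝 0) := by
  have hC0 : 0 ≤ C := (mass_nonneg _).trans (hC 0)
  rw [tendsto_zero_iff_norm_tendsto_zero, Metric.tendsto_atTop']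
  intro ε hε
  -- `K` bounds the sum of the squared masses of `a + b m`, `a` and `b m`, which multiplies the
  -- truncation error `δ`.
  set K := (2 * mass a + 2 * C) ^ 2 + mass a ^ 2 + C ^ 2 with hK
  have hK0 : 0 ≤ K := by positivity
  set δ := ε / (2 * (K + 1)) with hδ
  have hδ0 : 0 < δ := by positivity
  obtain ⟨F, hF⟩ := exists_finset_norm_quartic_sub_le hc hδ0
  let Q : (ℤ → ℂ) → ℂ := fun a => ∑ p ∈ F, c p * ∑' n, quad a p n
  have hfin : Tendsto (fun m => Q (a + b m) - Q a - Q (b m)) atTop (𝓝 0) := by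
    have h1 : Tendsto (fun m => ∑ p ∈ F, c p * (∑' n, quad (a + b m) p n - ∑' n, quad a p n -
        ∑' n, quad (b m) p n)) atTop (𝓝 (∑ p ∈ F, c p * 0)) :=
      tendsto_finsetSum _ fun p _ => (tendsto_tsum_quad_add_sub ha hb hC hlim p).const_mul _
    simpa only [Q, mul_zero, Finset.sum_const_zero, mul_sub, Finset.sum_sub_distrib] using h1
  obtain ⟨N, hN⟩ := (hfin.norm.eventually_lt_const
    (u := ε / 2) (by simpa using half_pos hε)).exists_forall_of_atTop
  refine ⟨N, fun m hm => ?_⟩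
  rw [Real.dist_eq, sub_zero, abs_of_nonneg (norm_nonneg _)]
  have hab : mass (a + b m) ≤ 2 * mass a + 2 * C :=
    (mass_add_le ha (hb m)).trans (by linarith [hC m])
  have e1 := hF _ (ha.add (hb m))
  have e2 := hF _ ha
  have e3 := hF _ (hb m)
  have h3 : δ * mass (a + b m) ^ 2 + δ * mass a ^ 2 + δ * mass (b m) ^ 2 ≤ δ * K := by
    rw [hK, ← mul_add, ← mul_add]
    have := mass_nonneg (a + b m)
    have := mass_nonneg (b m)
    have := hC m
    gcongr
  have h4 : δ * K < ε / 2 := by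
    have : δ * (K + 1) = ε / 2 := by rw [hδ]; field_simp
    linarith
  have h5 : quartic c (a + b m) - quartic c a - quartic c (b m) =
      (quartic c (a + b m) - Q (a + b m)) - (quartic c a - Q a) - (quartic c (b m) - Q (b m)) +
      (Q (a + b m) - Q a - Q (b m)) := by ring
  rw [h5]
  calc _ ≤ ‖quartic c (a + b m) - Q (a + b m)‖ + ‖quartic c a - Q a‖ + ‖quartic c (b m) - Q (b m)‖ +
        ‖Q (a + b m) - Q a - Q (b m)‖ :=
        (norm_add_le _ _).trans (add_le_add_left ((norm_sub_le _ _).trans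
          (add_le_add_left (norm_sub_le _ _) _)) _)
    _ < ε := by linarith [hN m hm.le]

/-- A sequence on which the quartic form is not small has a coefficient that is not small. -/
lemma exists_le_norm_of_le_quartic {c : ℤ × ℤ → ℂ} (hc : Summable fun p => ‖c p‖ ^ 2) {η : ℝ}
    (hη : 0 < η) : ∃ ε > 0, ∀ a, SqSummable a → mass a ≤ 1 → η ≤ (quartic c a).re →
      ∃ n, ε ≤ ‖a n‖ := by
  obtain ⟨F, hF⟩ := exists_finset_norm_quartic_sub_le hc (half_pos (half_pos hη))
  set D := ∑ p ∈ F, ‖c p‖ with hD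
  have hD0 : 0 ≤ D := Finset.sum_nonneg fun _ _ => norm_nonneg _
  -- The finite part is at most `D ε²`; this choice makes it at most `η/4`, like the truncation
  -- error, for a total below `η`.
  set ε := √(η / (4 * (D + 1))) with hε
  refine ⟨ε, by positivity, fun a ha ha1 hle => ?_⟩
  by_contra! hlt
  have hq : ∀ p, ‖∑' n, quad a p n‖ ≤ ε ^ 2 := by
    intro p
    have h1 : ‖∑' n, quad a p n‖ ≤ ε ^ 2 * ∑' n, ‖a n‖ * ‖a (n + p.1)‖ := by
      rw [← tsum_mul_left]
      refine tsum_of_norm_bounded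
        (((ha.summable_norm_mul (ha.comp_add p.1)).mul_left (ε ^ 2)).hasSum) fun n => ?_
      rw [norm_quad]
      calc _ = (‖a (n + p.2)‖ * ‖a (n + p.1 + p.2)‖) * (‖a n‖ * ‖a (n + p.1)‖) := by ring
        _ ≤ ε * ε * (‖a n‖ * ‖a (n + p.1)‖) := by
            gcongr
            · exact (hlt _).le
            · exact (hlt _).le
        _ = _ := by ring
    have h2 := ha.tsum_norm_mul_le (ha.comp_add p.1)
    rw [mass_comp_add, Real.mul_self_sqrt (mass_nonneg a)] at h2
    calc _ ≤ _ := h1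
      _ ≤ ε ^ 2 * 1 := by gcongr; exact h2.trans ha1
      _ = ε ^ 2 := mul_one _
  have h1 : ‖∑ p ∈ F, c p * ∑' n, quad a p n‖ ≤ D * ε ^ 2 := by
    rw [hD, Finset.sum_mul]
    refine (norm_sum_le _ _).trans (Finset.sum_le_sum fun p _ => ?_)
    rw [norm_mul]
    gcongr
    exact hq p
  have h2 : D * ε ^ 2 ≤ η / 4 := by
    rw [hε, Real.sq_sqrt (by positivity)]
    have : (D + 1) * (η / (4 * (D + 1))) = η / 4 := by field_simp
    have h0 : 0 ≤ η / (4 * (D + 1)) := by positivity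
    linarith
  have h3 : ‖quartic c a‖ ≤ η / 4 + η / 4 := by
    have e := hF a ha
    have : η / 2 / 2 * mass a ^ 2 ≤ η / 4 := by
      have := mass_nonneg a
      have : mass a ^ 2 ≤ 1 := pow_le_one₀ this ha1
      nlinarith
    have t := norm_add_le (quartic c a - ∑ p ∈ F, c p * ∑' n, quad a p n)
      (∑ p ∈ F, c p * ∑' n, quad a p n)
    rw [sub_add_cancel] at t
    linarith
  linarith [Complex.re_le_norm (quartic c a)]

/-- The form is homogeneous of degree four; mass zero is separate because it cannot be normalized.
-/
lemma quartic_re_le_mul_mass_sq {c : ℤ × ℤ → ℂ} {M : ℝ}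
    (hM : ∀ a, SqSummable a → mass a = 1 → (quartic c a).re ≤ M) {a : ℤ → ℂ} (ha : SqSummable a) :
    (quartic c a).re ≤ M * mass a ^ 2 := by
  rcases (mass_nonneg a).eq_or_lt with h0 | hpos
  · have hz : a = (0 : ℝ) • a := by
      ext n
      have := ha.norm_sq_le_mass n
      rw [← h0] at this
      simpa using this
    have h1 : quartic c a = 0 := by
      rw [hz]
      have := quartic_smul c a 0
      simpa using this
    rw [h1, ← h0]
    simp
  · set s := √(mass a) with hs
    have hspos : 0 < s := Real.sqrt_pos.2 hpos
    have hs2 : s ^ 2 = mass a := Real.sq_sqrt hpos.le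
    have h1 : mass (((s⁻¹ : ℝ) : ℂ) • a) = 1 := by
      rw [mass_smul, Complex.norm_real, Real.norm_of_nonneg (by positivity), ← hs2]
      field_simp
    have h2 := hM _ (ha.smul _) h1
    rw [quartic_smul, ← Complex.ofReal_pow, Complex.re_ofReal_mul] at h2
    have h3 : mass a ^ 2 = s ^ 4 := by rw [← hs2]; ring
    rw [h3]
    have h4 : (quartic c a).re = s ^ 4 * (s⁻¹ ^ 4 * (quartic c a).re) := by
      field_simp
    rw [h4, mul_comm M]
    gcongr

/-! ### Compactness of maximizing sequences -/

lemma exists_subseq_tendsto_pointwise {a : ℕ → ℤ → ℂ} (h : ∀ m n, ‖a m n‖ ≤ 1) :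
    ∃ (b : ℤ → ℂ) (φ : ℕ → ℕ), StrictMono φ ∧ ∀ n, Tendsto (fun m => a (φ m) n) atTop (𝓝 (b n)) := by
  have hK : IsCompact (Set.univ.pi fun _ : ℤ => Metric.closedBall (0 : ℂ) 1) :=
    isCompact_univ_pi fun _ => isCompact_closedBall _ _
  obtain ⟨b, -, φ, hφ, hlim⟩ := hK.tendsto_subseq (x := a) fun m => by
    simpa [Set.mem_pi] using h m
  exact ⟨b, φ, hφ, fun n => (tendsto_pi_nhds.1 hlim) n⟩

lemma sqSummable_and_mass_le_of_tendsto {a : ℕ → ℤ → ℂ} {b : ℤ → ℂ} (ha : ∀ m, SqSummable (a m))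
    {C : ℝ} (hC : ∀ m, mass (a m) ≤ C) (hlim : ∀ n, Tendsto (fun m => a m n) atTop (𝓝 (b n))) :
    SqSummable b ∧ mass b ≤ C := by
  have key : ∀ F : Finset ℤ, ∑ n ∈ F, ‖b n‖ ^ 2 ≤ C := by
    intro F
    have h1 : Tendsto (fun m => ∑ n ∈ F, ‖a m n‖ ^ 2) atTop (𝓝 (∑ n ∈ F, ‖b n‖ ^ 2)) :=
      tendsto_finsetSum _ fun n _ => (hlim n).norm.pow 2
    refine le_of_tendsto h1 (Eventually.of_forall fun m => ?_)
    exact (Summable.sum_le_tsum F (fun _ _ => by positivity) (ha m)).trans (hC m)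
  exact ⟨summable_of_sum_le (fun _ => by positivity) key,
    Real.tsum_le_of_sum_le (fun _ => by positivity) key⟩

/-- Pythagoras up to the cross term `2 Re ⟨x m - a, a⟩`, which tends to zero because `x m - a` is
weakly null. -/
lemma tendsto_mass_sub {a : ℤ → ℂ} (ha : SqSummable a) {x : ℕ → ℤ → ℂ}
    (hx : ∀ m, SqSummable (x m)) (hx1 : ∀ m, mass (x m) = 1)
    (hlim : ∀ n, Tendsto (fun m => x m n) atTop (𝓝 (a n))) :
    Tendsto (fun m => mass (x m - a)) atTop (𝓝 (1 - mass a)) := by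
  have hy : ∀ m, SqSummable (x m - a) := fun m => (hx m).sub ha
  have hC : ∀ m, mass (x m - a) ≤ 2 + 2 * mass a := fun m => by
    have := mass_add_le (hx m) ha.neg
    rw [← sub_eq_add_neg, hx1] at this
    have h2 : mass (-a) = mass a := by simp [mass]
    linarith
  have h0 : ∀ n, Tendsto (fun m => (x m - a) n) atTop (𝓝 0) := fun n => by
    simpa using (hlim n).sub_const (a n)
  have h1 := tendsto_tsum_norm_mul ha hy hC h0
  have h2 : ∀ m, |mass (x m - a) - (1 - mass a)| ≤ 2 * ∑' n, ‖a n‖ * ‖(x m - a) n‖ := by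
    intro m
    have e : mass (x m - a) - (1 - mass a) =
        ∑' n, (‖(x m - a) n‖ ^ 2 - (‖x m n‖ ^ 2 - ‖a n‖ ^ 2)) := by
      have s1 : Summable fun n => ‖(x m - a) n‖ ^ 2 := hy m
      have s2 : Summable fun n => ‖x m n‖ ^ 2 := hx m
      have s3 : Summable fun n => ‖a n‖ ^ 2 := ha
      rw [s1.tsum_sub (s2.sub s3), s2.tsum_sub s3, ← hx1 m]
      rfl
    rw [e, ← Real.norm_eq_abs, ← tsum_mul_left]
    refine tsum_of_norm_bounded (((ha.summable_norm_mul (hy m)).mul_left 2).hasSum) fun n => ?_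
    simp only [Pi.sub_apply, Real.norm_eq_abs]
    have e2 : ‖x m n‖ ^ 2 = ‖x m n - a n‖ ^ 2 + ‖a n‖ ^ 2 +
        2 * inner ℝ (x m n - a n) (a n) := by
      have := norm_add_sq_real (x m n - a n) (a n)
      rw [sub_add_cancel] at this
      linarith
    rw [e2]
    have := abs_real_inner_le_norm (x m n - a n) (a n)
    rw [show ‖x m n - a n‖ ^ 2 - (‖x m n - a n‖ ^ 2 + ‖a n‖ ^ 2 +
      2 * inner ℝ (x m n - a n) (a n) - ‖a n‖ ^ 2) = -(2 * inner ℝ (x m n - a n) (a n)) by ring,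
      abs_neg, abs_mul, abs_two]
    linarith
  rw [tendsto_iff_norm_sub_tendsto_zero]
  refine squeeze_zero (fun _ => norm_nonneg _) h2 ?_
  simpa using h1.const_mul 2

/-- If a quartic form with square summable coefficients is positive somewhere, then it attains its
maximum on the unit sphere of `ℓ²(ℤ)`. -/
theorem exists_maximizer_quartic {c : ℤ × ℤ → ℂ} (hc : Summable fun p => ‖c p‖ ^ 2)
    (hpos : ∃ a, SqSummable a ∧ 0 < (quartic c a).re) :
    ∃ a, SqSummable a ∧ mass a = 1 ∧
      ∀ b, SqSummable b → (quartic c b).re ≤ (quartic c a).re * mass b ^ 2 := by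
  let V : Set ℝ := {v | ∃ a, SqSummable a ∧ mass a = 1 ∧ (quartic c a).re = v}
  have hbdd : BddAbove V := by
    refine ⟨√(∑' p, ‖c p‖ ^ 2), ?_⟩
    rintro _ ⟨a, ha, h1, rfl⟩
    have := (Complex.re_le_norm _).trans (norm_quartic_le hc ha)
    simpa [h1] using this
  obtain ⟨a₀, ha₀, hpos₀⟩ := hpos
  have hM : ∀ a, SqSummable a → mass a = 1 → (quartic c a).re ≤ sSup V :=
    fun a ha h1 => le_csSup hbdd ⟨a, ha, h1, rfl⟩
  set M := sSup V with hMdef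
  have hM' := fun {a : ℤ → ℂ} (ha : SqSummable a) => quartic_re_le_mul_mass_sq hM ha
  have hMpos : 0 < M := by
    by_contra! hneg
    have := hM' ha₀
    have h2 : M * mass a₀ ^ 2 ≤ 0 := mul_nonpos_of_nonpos_of_nonneg hneg (by positivity)
    linarith
  have hVne : V.Nonempty := by
    by_contra hne
    rw [Set.not_nonempty_iff_eq_empty] at hne
    rw [hMdef, hne, Real.sSup_empty] at hMpos
    exact lt_irrefl _ hMpos
  obtain ⟨v, -, hvlim, hvV⟩ := exists_seq_tendsto_sSup hVne hbdd
  choose x hx hx1 hxv using hvV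
  obtain ⟨N, hN⟩ := (hvlim.eventually_const_lt (half_lt_self hMpos)).exists_forall_of_atTop
  -- Positivity of `M` excludes vanishing: far along the sequence some coefficient has size at least
  -- `ε`, and translation brings it to the origin.
  obtain ⟨ε, hε, hconc⟩ := exists_le_norm_of_le_quartic hc (half_pos hMpos)
  have hs : ∀ m, ∃ s, ε ≤ ‖x (m + N) s‖ := fun m =>
    hconc _ (hx _) (hx1 _).le (by rw [hxv]; exact (hN _ (Nat.le_add_left _ _)).le)
  choose s hs using hs
  let y : ℕ → ℤ → ℂ := fun m n => x (m + N) (n + s m)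
  have hy : ∀ m, SqSummable (y m) := fun m => (hx _).comp_add _
  have hy1 : ∀ m, mass (y m) = 1 := fun m => (mass_comp_add _ _).trans (hx1 _)
  have hyv : Tendsto (fun m => (quartic c (y m)).re) atTop (𝓝 M) := by
    have : (fun m => (quartic c (y m)).re) = fun m => v (m + N) := by
      ext m
      rw [← hxv, ← quartic_comp_add c (x (m + N)) (s m)]
    rw [this]
    exact (tendsto_add_atTop_iff_nat N).2 hvlim
  have hyle : ∀ m n, ‖y m n‖ ≤ 1 := fun m n => by
    have := (hy m).norm_le n
    rwa [hy1, Real.sqrt_one] at this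
  obtain ⟨a, φ, hφ, hlim⟩ := exists_subseq_tendsto_pointwise hyle
  obtain ⟨ha, ha1⟩ := sqSummable_and_mass_le_of_tendsto (fun m => hy (φ m))
    (fun m => (hy1 (φ m)).le) hlim
  have hyvφ : Tendsto (fun m => (quartic c (y (φ m))).re) atTop (𝓝 M) :=
    hyv.comp hφ.tendsto_atTop
  set θ := mass a with hθ
  have hθpos : 0 < θ := by
    have h0 : ε ≤ ‖a 0‖ := by
      refine ge_of_tendsto (hlim 0).norm (Eventually.of_forall fun m => ?_)
      simpa [y] using hs (φ m)
    have := ha.norm_sq_le_mass 0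
    nlinarith
  let b : ℕ → ℤ → ℂ := fun m => y (φ m) - a
  have hb : ∀ m, SqSummable (b m) := fun m => (hy _).sub ha
  have hblim : ∀ n, Tendsto (fun m => b m n) atTop (𝓝 0) := fun n => by
    simpa [b] using (hlim n).sub_const (a n)
  have hbmass : Tendsto (fun m => mass (b m)) atTop (𝓝 (1 - θ)) :=
    tendsto_mass_sub ha (fun m => hy (φ m)) (fun m => hy1 (φ m)) hlim
  have hbC : ∀ m, mass (b m) ≤ 4 := fun m => by
    have := mass_add_le (hy (φ m)) ha.neg
    rw [← sub_eq_add_neg, hy1] at this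
    have h2 : mass (-a) = mass a := by simp [mass]
    have h3 : mass (b m) = mass (y (φ m) - a) := rfl
    linarith
  have hsplit : Tendsto (fun m => (quartic c (y (φ m))).re - (quartic c a).re -
      (quartic c (b m)).re) atTop (𝓝 0) := by
    have h1 := (Complex.continuous_re.tendsto _).comp (tendsto_quartic_add_sub hc ha hb hbC hblim)
    have h2 : ∀ m, a + b m = y (φ m) := fun m => add_sub_cancel _ _
    simpa [Function.comp_def, h2] using h1
  have hGb : Tendsto (fun m => (quartic c (b m)).re) atTop (𝓝 (M - (quartic c a).re)) := by
    have := (hyvφ.sub_const (quartic c a).re).sub hsplit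
    simpa using this
  -- The remainder `b m` carries mass tending to `1 - θ` and value tending to `M - G(a)`, where `G`
  -- is the real part of the form.
  have hkey : M - (quartic c a).re ≤ M * (1 - θ) ^ 2 :=
    le_of_tendsto_of_tendsto' hGb ((hbmass.pow 2).const_mul M) fun m => hM' (hb m)
  have hGa := hM' ha
  -- With `G(a) ≤ M θ²` this gives `M ≤ M (θ² + (1-θ)²)`, impossible for `0 < θ < 1`.
  have hθ1 : θ = 1 := by
    by_contra hne
    have hlt : θ < 1 := lt_of_le_of_ne ha1 hne
    nlinarith [mul_pos hMpos (mul_pos hθpos (sub_pos.2 hlt))]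
  refine ⟨a, ha, hθ1, fun b hb => (hM' hb).trans ?_⟩
  rw [hθ1] at hkey
  have : M ≤ (quartic c a).re := by linarith
  gcongr

/-! ### The functional `W` as a quartic form -/

/-- The character `e^{2imt}`. -/
def phase (m : ℤ) (t : ℝ) : ℂ := Complex.exp (2 * Complex.I * m * t)

lemma phase_eq (m : ℤ) (t : ℝ) : phase m t = Complex.exp ((2 * m * t : ℝ) * Complex.I) := by
  rw [phase]; push_cast; ring_nf

lemma norm_phase (m : ℤ) (t : ℝ) : ‖phase m t‖ = 1 := by
  rw [phase_eq, Complex.norm_exp_ofReal_mul_I]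

lemma continuous_phase (m : ℤ) : Continuous (phase m) := by
  unfold phase; fun_prop

lemma phase_add (m n : ℤ) (t : ℝ) : phase (m + n) t = phase m t * phase n t := by
  rw [phase, phase, phase, ← Complex.exp_add]
  push_cast
  ring_nf

lemma conj_phase (m : ℤ) (t : ℝ) : conj (phase m t) = phase (-m) t := by
  rw [phase_eq, phase_eq, ← Complex.exp_conj]
  congr 1
  simp only [map_mul, Complex.conj_ofReal, Complex.conj_I]
  push_cast
  ring

lemma phase_zero (t : ℝ) : phase 0 t = 1 := by simp [phase]

lemma re_phase (m : ℤ) (t : ℝ) : (phase m t).re = Real.cos (2 * m * t) := by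
  rw [phase_eq, Complex.exp_ofReal_mul_I_re]

/-- The time integral `∫₀^B e^{2imt} dt`. -/
def osc (B : ℝ) (m : ℤ) : ℂ := ∫ t in (0 : ℝ)..B, phase m t

lemma osc_zero (B : ℝ) : osc B 0 = B := by simp [osc, phase_zero]

lemma osc_eq_div (B : ℝ) {m : ℤ} (hm : m ≠ 0) : osc B m = (phase m B - 1) / (2 * Complex.I * m) := by
  have hc : (2 * Complex.I * m : ℂ) ≠ 0 := by simp [hm]
  unfold osc phase
  rw [integral_exp_mul_complex hc]
  simp

lemma norm_osc_le (B : ℝ) {m : ℤ} (hm : m ≠ 0) : ‖osc B m‖ ≤ 1 / |(m : ℝ)| := by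
  have h2 : ‖(2 * Complex.I * m : ℂ)‖ = 2 * |(m : ℝ)| := by simp
  have h3 : ‖phase m B - 1‖ ≤ 2 := by
    refine (norm_sub_le _ _).trans ?_
    rw [norm_phase, norm_one]
    norm_num
  have hm' : 0 < |(m : ℝ)| := abs_pos.2 (by exact_mod_cast hm)
  rw [osc_eq_div B hm, norm_div, h2, div_le_div_iff₀ (by positivity) hm']
  nlinarith

/-- The coefficients of the quartic form attached to the time interval `[0, B]`. -/
def coeff (B : ℝ) (p : ℤ × ℤ) : ℂ :=
  if p = 0 then -B else if p.1 * p.2 = 0 then 0 else osc B (p.1 * p.2)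

/-- Off the axes the bound is `1/(jk)²`, a product of convergent series. The origin is added
separately, as `1/0 = 0` gives nothing there. -/
lemma summable_norm_coeff_sq (B : ℝ) : Summable fun p => ‖coeff B p‖ ^ 2 := by
  have h1 : Summable fun n : ℤ => 1 / (n : ℝ) ^ 2 := Real.summable_one_div_int_pow.2 one_lt_two
  have h2 : Summable fun p : ℤ × ℤ => 1 / (p.1 : ℝ) ^ 2 * (1 / (p.2 : ℝ) ^ 2) := by
    have := Summable.mul_of_nonneg (f := fun n : ℤ => 1 / (n : ℝ) ^ 2)
      (g := fun n : ℤ => 1 / (n : ℝ) ^ 2) h1 h1 (fun _ => by positivity) (fun _ => by positivity)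
    simpa only using this
  have h3 : Summable fun p : ℤ × ℤ => if p = 0 then B ^ 2 else 0 :=
    summable_of_ne_finset_zero (s := {0}) fun p hp => if_neg (by simpa using hp)
  refine Summable.of_nonneg_of_le (fun _ => by positivity) (fun p => ?_) (h2.add h3)
  unfold coeff
  split_ifs with h h'
  · subst h; simp
  · simp only [norm_zero, ne_eq, OfNat.ofNat_ne_zero, not_false_eq_true, zero_pow, add_zero]
    positivity
  · have := norm_osc_le B h'
    rw [add_zero]
    calc ‖osc B (p.1 * p.2)‖ ^ 2 ≤ (1 / |((p.1 * p.2 : ℤ) : ℝ)|) ^ 2 := by gcongr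
      _ = 1 / (p.1 : ℝ) ^ 2 * (1 / (p.2 : ℝ) ^ 2) := by
        rw [div_pow, sq_abs]; push_cast; field_simp

/-- The time-dependent correlation `∑ₙ conj a_n a_{n+m} e^{-2inmt}`. -/
def corr (a : ℤ → ℂ) (m : ℤ) (t : ℝ) : ℂ := ∑' n, conj (a n) * a (n + m) * phase (-(n * m)) t

lemma norm_corr_term (a : ℤ → ℂ) (m n : ℤ) (t : ℝ) :
    ‖conj (a n) * a (n + m) * phase (-(n * m)) t‖ = ‖a n‖ * ‖a (n + m)‖ := by
  rw [norm_mul, norm_mul, norm_phase, RCLike.norm_conj, mul_one]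

lemma continuous_corr {a : ℤ → ℂ} (ha : SqSummable a) (m : ℤ) : Continuous (corr a m) :=
  continuous_tsum (fun _ => continuous_const.mul (continuous_phase _))
    (ha.summable_norm_mul (ha.comp_add m)) fun n t => (norm_corr_term a m n t).le

/-- The change of variables `(k, n) ↦ (n, n + k)`. -/
def shearEquiv : ℤ × ℤ ≃ ℤ × ℤ where
  toFun p := (p.2, p.2 + p.1)
  invFun p := (p.2 - p.1, p.1)
  left_inv p := by ext <;> simp
  right_inv p := by ext <;> simp

/-- Expand the square over pairs `(n, n + k)`: the phases `e^{-2inmt}` and `e^{2i(n+k)mt}` multiply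
to `e^{2imkt}`, free of `n`. -/
lemma hasSum_norm_corr_sq {a : ℤ → ℂ} (ha : SqSummable a) (m : ℤ) (t : ℝ) :
    HasSum (fun p : ℤ × ℤ => quad a (m, p.1) p.2 * phase (m * p.1) t)
      ((‖corr a m t‖ ^ 2 : ℝ) : ℂ) := by
  have hn : Summable fun n => ‖conj (a n) * a (n + m) * phase (-(n * m)) t‖ := by
    simp_rw [norm_corr_term]
    exact ha.summable_norm_mul (ha.comp_add m)
  have hn' : Summable fun n => ‖conj (conj (a n) * a (n + m) * phase (-(n * m)) t)‖ := by
    simpa only [RCLike.norm_conj] using hn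
  have hs := summable_mul_of_summable_norm hn hn'
  have h1 : HasSum (fun n => conj (a n) * a (n + m) * phase (-(n * m)) t) (corr a m t) :=
    hn.of_norm.hasSum
  have h2 : HasSum (fun n => conj (conj (a n) * a (n + m) * phase (-(n * m)) t))
      (conj (corr a m t)) := Complex.hasSum_conj'.2 h1
  have h3 := h1.mul h2 hs
  rw [← shearEquiv.hasSum_iff, Complex.mul_conj, Complex.normSq_eq_norm_sq] at h3
  have e : (fun p : ℤ × ℤ => quad a (m, p.1) p.2 * phase (m * p.1) t) =
      (fun p : ℤ × ℤ => conj (a p.1) * a (p.1 + m) * phase (-(p.1 * m)) t *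
        conj (conj (a p.2) * a (p.2 + m) * phase (-(p.2 * m)) t)) ∘ shearEquiv := by
    ext p
    simp only [shearEquiv, Equiv.coe_fn_mk, Function.comp, quad, map_mul, Complex.conj_conj,
      conj_phase]
    have hp : phase (m * p.1) t = phase (-(p.2 * m)) t * phase (- -((p.2 + p.1) * m)) t := by
      rw [← phase_add]; congr 1; ring
    rw [hp, add_right_comm p.2 m p.1]
    ring
  rw [e]
  exact h3

lemma hasSum_integral_norm_corr_sq {a : ℤ → ℂ} (ha : SqSummable a) (m : ℤ) (B : ℝ) :
    HasSum (fun p : ℤ × ℤ => osc B (m * p.1) * quad a (m, p.1) p.2)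
      ((∫ t in (0 : ℝ)..B, ‖corr a m t‖ ^ 2 : ℝ) : ℂ) := by
  have hb : Summable fun p : ℤ × ℤ => ‖quad a (m, p.1) p.2‖ := by
    have := (hasSum_norm_corr_sq ha m 0).summable.norm
    simpa only [norm_mul, norm_phase, mul_one] using this
  have := intervalIntegral.hasSum_integral_of_dominated_convergence (μ := volume) (a := 0) (b := B)
    (F := fun (p : ℤ × ℤ) t => quad a (m, p.1) p.2 * phase (m * p.1) t)
    (f := fun t => ((‖corr a m t‖ ^ 2 : ℝ) : ℂ))
    (fun p _ => ‖quad a (m, p.1) p.2‖)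
    (fun p => (continuous_const.mul (continuous_phase _)).aestronglyMeasurable)
    (fun p => ae_of_all _ fun t _ => by rw [norm_mul, norm_phase, mul_one])
    (ae_of_all _ fun _ _ => hb) intervalIntegrable_const
    (ae_of_all _ fun t _ => hasSum_norm_corr_sq ha m t)
  rw [intervalIntegral.integral_ofReal] at this
  have e : (fun p : ℤ × ℤ => osc B (m * p.1) * quad a (m, p.1) p.2) =
      fun p : ℤ × ℤ => ∫ t in (0 : ℝ)..B, quad a (m, p.1) p.2 * phase (m * p.1) t := by
    ext p
    rw [intervalIntegral.integral_const_mul, osc, mul_comm]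
  rw [e]
  exact this

lemma hasSum_quad_zero_left {a : ℤ → ℂ} (ha : SqSummable a) :
    HasSum (fun p : ℤ × ℤ => quad a (0, p.1) p.2) ((mass a ^ 2 : ℝ) : ℂ) := by
  have h1 := (ha.hasSum.mul ha.hasSum (Summable.mul_of_nonneg (f := fun n => ‖a n‖ ^ 2)
    (g := fun n => ‖a n‖ ^ 2) ha ha (fun _ => by positivity) (fun _ => by positivity)))
  rw [← shearEquiv.hasSum_iff] at h1
  have h2 := Complex.hasSum_ofReal.2 h1
  rw [← sq, ← mass] at h2
  convert h2 using 2 with p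
  simp only [shearEquiv, Equiv.coe_fn_mk, Function.comp, quad, add_zero]
  push_cast
  rw [← Complex.conj_mul', ← Complex.mul_conj']
  ring

lemma hasSum_quad_zero_right {a : ℤ → ℂ} (ha : SqSummable a) :
    HasSum (fun p : ℤ × ℤ => quad a (p.1, 0) p.2) ((mass a ^ 2 : ℝ) : ℂ) := by
  convert hasSum_quad_zero_left ha using 2 with p
  simp only [quad, add_zero]
  ring

/-- The two axes each carry `B` and both count the origin; the value `-B` of `coeff B` there
corrects this. -/
lemma osc_eq (B : ℝ) (p : ℤ × ℤ) : osc B (p.1 * p.2) =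
    coeff B p + (if p.1 = 0 then (B : ℂ) else 0) + (if p.2 = 0 then (B : ℂ) else 0) := by
  obtain ⟨j, k⟩ := p
  by_cases hj : j = 0 <;> by_cases hk : k = 0 <;> simp [coeff, hj, hk, osc_zero]

lemma hasSum_osc_mul_quad {a : ℤ → ℂ} (ha : SqSummable a) (B : ℝ) :
    HasSum (fun q : (ℤ × ℤ) × ℤ => osc B (q.1.1 * q.1.2) * quad a q.1 q.2)
      (quartic (coeff B) a + B * (mass a ^ 2 : ℝ) + B * (mass a ^ 2 : ℝ)) := by
  have h0 := (summable_quartic (summable_norm_coeff_sq B) ha).hasSum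
  rw [← quartic] at h0
  let i₁ : ℤ × ℤ → (ℤ × ℤ) × ℤ := fun p => ((0, p.1), p.2)
  let i₂ : ℤ × ℤ → (ℤ × ℤ) × ℤ := fun p => ((p.1, 0), p.2)
  have hi₁ : Function.Injective i₁ := fun p q h => by
    simp only [i₁, Prod.mk.injEq, true_and] at h; exact Prod.ext h.1 h.2
  have hi₂ : Function.Injective i₂ := fun p q h => by
    simp only [i₂, Prod.mk.injEq, and_true] at h; exact Prod.ext h.1 h.2
  have h1 : HasSum (fun q : (ℤ × ℤ) × ℤ => (if q.1.1 = 0 then (B : ℂ) else 0) * quad a q.1 q.2)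
      (B * (mass a ^ 2 : ℝ)) := by
    rw [← hi₁.hasSum_iff]
    · simpa [i₁, Function.comp_def] using (hasSum_quad_zero_left ha).mul_left (B : ℂ)
    · rintro ⟨⟨j, k⟩, n⟩ hq
      have : j ≠ 0 := by rintro rfl; exact hq ⟨(k, n), rfl⟩
      simp [this]
  have h2 : HasSum (fun q : (ℤ × ℤ) × ℤ => (if q.1.2 = 0 then (B : ℂ) else 0) * quad a q.1 q.2)
      (B * (mass a ^ 2 : ℝ)) := by
    rw [← hi₂.hasSum_iff]
    · simpa [i₂, Function.comp_def] using (hasSum_quad_zero_right ha).mul_left (B : ℂ)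
    · rintro ⟨⟨j, k⟩, n⟩ hq
      have : k ≠ 0 := by rintro rfl; exact hq ⟨(j, n), rfl⟩
      simp [this]
  convert (h0.add h1).add h2 using 2 with q
  rw [osc_eq]
  ring

lemma hasSum_integral_norm_corr_sq_total {a : ℤ → ℂ} (ha : SqSummable a) (B : ℝ) :
    HasSum (fun m => ∫ t in (0 : ℝ)..B, ‖corr a m t‖ ^ 2)
      (2 * B * mass a ^ 2 + (quartic (coeff B) a).re) := by
  have h := hasSum_osc_mul_quad ha B
  rw [← (Equiv.prodAssoc ℤ ℤ ℤ).symm.hasSum_iff] at h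
  have h1 := h.prod_fiberwise fun m => hasSum_integral_norm_corr_sq ha m B
  have h2 := Complex.hasSum_re h1
  simp only [Complex.ofReal_re] at h2
  convert h2 using 1
  simp only [Complex.add_re, Complex.re_ofReal_mul, Complex.ofReal_re]
  ring

/-- In `n² - (n+m)² = -2nm - m²` the part `-m²` gives a unimodular factor independent of `n`. -/
lemma tsum_conj_mul_propagator (t : ℝ) (u : L2T) (m : ℤ) :
    ‖∑' n : ℤ, conj (fourierCoeff (propagator t u) n) * fourierCoeff (propagator t u) (n + m)‖ =
      ‖corr (fourierCoeff u) m t‖ := by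
  have h : ∀ n : ℤ, conj (fourierCoeff (propagator t u) n) * fourierCoeff (propagator t u) (n + m) =
      symbol t m * (conj (fourierCoeff u n) * fourierCoeff u (n + m) * phase (-(n * m)) t) := by
    intro n
    rw [fourierCoeff_propagator, fourierCoeff_propagator, map_mul, ← Complex.exp_conj]
    have e : Complex.exp (conj (-Complex.I * (n : ℂ) ^ 2 * (t : ℂ))) *
        Complex.exp (-Complex.I * ((n + m : ℤ) : ℂ) ^ 2 * (t : ℂ)) =
        symbol t m * phase (-(n * m)) t := by
      rw [symbol, phase, ← Complex.exp_add, ← Complex.exp_add]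
      congr 1
      simp only [map_mul, map_neg, Complex.conj_I, map_pow, Complex.conj_ofReal, map_intCast]
      push_cast
      ring
    linear_combination (conj (fourierCoeff u n) * fourierCoeff u (n + m)) * e
  simp_rw [h]
  rw [tsum_mul_left, norm_mul, norm_symbol, one_mul, corr]

lemma fourierCoeff_sqSummable_and_mass (u : L2T) :
    SqSummable (fourierCoeff u) ∧ mass (fourierCoeff u) = (2 * Real.pi)⁻¹ * ‖u‖ ^ 2 := by
  have hs := hasSum_sq_fourierCoeff (toHaar u)
  rw [fourierCoeff_toHaar] at hs
  refine ⟨hs.summable, ?_⟩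
  rw [mass, hs.tsum_eq]
  have h1 : ∫ x : Torus, ‖toHaar u x‖ ^ 2 ∂haarAddCircle = ∫ x : Torus, ‖u x‖ ^ 2 ∂haarAddCircle := by
    refine integral_congr_ae ?_
    filter_upwards [(memLp_haarAddCircle_iff.2 (Lp.memLp u)).coeFn_toLp] with x hx
    rw [toHaar, hx]
  rw [h1, integral_haarAddCircle, smul_eq_mul]
  congr 1
  have H := congr_arg RCLike.re (@L2.inner_def Torus ℂ ℂ _ _ _ _ _ u u)
  rw [← integral_re (L2.integrable_inner u u)] at H
  simp only [← norm_sq_eq_re_inner] at H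
  exact H.symm

/-- The Strichartz functional in terms of Fourier coefficients. -/
theorem W_eq {B : ℝ} (hB : 0 ≤ B) (u : L2T) :
    W B u = ENNReal.ofReal (2 * Real.pi * (2 * B * mass (fourierCoeff u) ^ 2 +
      (quartic (coeff B) (fourierCoeff u)).re)) := by
  set a : ℤ → ℂ := fourierCoeff u with ha_def
  have ha : SqSummable a := (fourierCoeff_sqSummable_and_mass u).1
  have hinner : ∀ t, ∫⁻ x : Torus, ‖propagator t u x‖ₑ ^ 4 =
      ENNReal.ofReal (2 * Real.pi) * ∑' m, ‖corr a m t‖ₑ ^ 2 := by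
    intro t
    rw [lintegral_enorm_pow_four (memLp_haarAddCircle_iff.2 (Lp.memLp (propagator t u)))]
    congr 1
    refine tsum_congr fun m => ?_
    rw [← ofReal_norm, tsum_conj_mul_propagator, ofReal_norm]
  have hm : ∀ m, Measurable fun t => ‖corr a m t‖ₑ ^ 2 := fun m =>
    ((continuous_corr ha m).measurable.enorm.pow_const 2)
  have hint : ∀ m, ∫⁻ t in Set.Icc 0 B, ‖corr a m t‖ₑ ^ 2 =
      ENNReal.ofReal (∫ t in (0 : ℝ)..B, ‖corr a m t‖ ^ 2) := by
    intro m
    rw [intervalIntegral.integral_of_le hB, ← integral_Icc_eq_integral_Ioc,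
      ofReal_integral_eq_lintegral_ofReal (f := fun t => ‖corr a m t‖ ^ 2)
        ((show Continuous fun t => ‖corr a m t‖ ^ 2 from
          (continuous_corr ha m).norm.pow 2).integrableOn_Icc) (ae_of_all _ fun _ => sq_nonneg _)]
    refine lintegral_congr fun t => ?_
    rw [ENNReal.ofReal_pow (norm_nonneg _), ofReal_norm]
  have hsum := hasSum_integral_norm_corr_sq_total ha B
  have hnn : ∀ m, 0 ≤ ∫ t in (0 : ℝ)..B, ‖corr a m t‖ ^ 2 := fun m =>
    intervalIntegral.integral_nonneg hB fun _ _ => by positivity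
  unfold W
  simp_rw [hinner]
  rw [lintegral_const_mul _ (Measurable.tsum hm), lintegral_tsum fun m => (hm m).aemeasurable]
  simp_rw [hint]
  rw [← ENNReal.ofReal_tsum_of_nonneg hnn hsum.summable, hsum.tsum_eq,
    ENNReal.ofReal_mul (by positivity : (0 : ℝ) ≤ 2 * Real.pi)]

/-! ### Positivity of the quartic form for chirped Dirichlet kernels -/

/-- The chirped Dirichlet kernel: `e^{iδn²}` on `0 ≤ n < N`. -/
def chirp (N : ℕ) (δ : ℝ) (n : ℤ) : ℂ :=
  if n ∈ Finset.Ico (0 : ℤ) N then Complex.exp (Complex.I * (n : ℂ) ^ 2 * δ) else 0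

/-- The number of `n` with `n, n + j, n + k, n + j + k` all in `[0, N)`. -/
def count (N : ℕ) (p : ℤ × ℤ) : ℕ :=
  ((Finset.Ico (0 : ℤ) N).filter fun n => n + p.1 ∈ Finset.Ico (0 : ℤ) N ∧
    n + p.2 ∈ Finset.Ico (0 : ℤ) N ∧ n + p.1 + p.2 ∈ Finset.Ico (0 : ℤ) N).card

lemma count_le (N : ℕ) (p : ℤ × ℤ) : count N p ≤ N := by
  refine (Finset.card_filter_le _ _).trans ?_
  simp

/-- All `n` at distance at least `|j| + |k|` from the ends of the interval qualify. -/
lemma le_count (N : ℕ) (p : ℤ × ℤ) : (N : ℤ) - 2 * (|p.1| + |p.2|) ≤ count N p := by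
  have hsub : Finset.Ico (|p.1| + |p.2|) (N - (|p.1| + |p.2|)) ⊆
      (Finset.Ico (0 : ℤ) N).filter fun n => n + p.1 ∈ Finset.Ico (0 : ℤ) N ∧
        n + p.2 ∈ Finset.Ico (0 : ℤ) N ∧ n + p.1 + p.2 ∈ Finset.Ico (0 : ℤ) N := by
    intro n hn
    simp only [Finset.mem_filter, Finset.mem_Ico] at hn ⊢
    have := abs_nonneg p.1
    have := abs_nonneg p.2
    have := neg_abs_le p.1
    have := neg_abs_le p.2
    have := le_abs_self p.1
    have := le_abs_self p.2
    omega
  have := Finset.card_le_card hsub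
  rw [Int.card_Ico] at this
  unfold count
  omega

lemma tendsto_count_div (p : ℤ × ℤ) :
    Tendsto (fun N : ℕ => (count N p : ℝ) / N) atTop (𝓝 1) := by
  have h1 : Tendsto (fun N : ℕ => 1 - (2 * (|(p.1 : ℝ)| + |(p.2 : ℝ)|)) / (N : ℝ)) atTop (𝓝 1) := by
    simpa using (tendsto_const_div_atTop_nhds_zero_nat (2 * (|(p.1 : ℝ)| + |(p.2 : ℝ)|))).const_sub 1
  refine tendsto_of_tendsto_of_tendsto_of_le_of_le' h1 tendsto_const_nhds ?_
    (Eventually.of_forall fun N => ?_)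
  · filter_upwards [eventually_gt_atTop 0] with N hN
    have hN' : (0 : ℝ) < N := by exact_mod_cast hN
    have h2 : (N : ℝ) - 2 * (|(p.1 : ℝ)| + |(p.2 : ℝ)|) ≤ count N p := by exact_mod_cast le_count N p
    rw [one_sub_div hN'.ne']
    gcongr
  · exact div_le_one_of_le₀ (by exact_mod_cast count_le N p) (Nat.cast_nonneg _)

lemma count_eq_zero {N : ℕ} {p : ℤ × ℤ}
    (hp : p ∉ Finset.Ioo (-N : ℤ) N ×ˢ Finset.Ioo (-N : ℤ) N) : count N p = 0 := by
  rw [count, Finset.card_eq_zero, Finset.filter_eq_empty_iff]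
  intro n hn h
  simp only [Finset.mem_product, Finset.mem_Ioo, Finset.mem_Ico] at *
  omega

lemma sqSummable_chirp (N : ℕ) (δ : ℝ) : SqSummable (chirp N δ) :=
  summable_of_ne_finset_zero (s := Finset.Ico (0 : ℤ) N) fun n hn => by simp [chirp, hn]

/-- The quadratic phase enters through its second difference `2jk`, so each admissible `n`
contributes the same value. -/
lemma tsum_quad_chirp (N : ℕ) (δ : ℝ) (p : ℤ × ℤ) :
    ∑' n, quad (chirp N δ) p n = count N p * phase (-(p.1 * p.2)) δ := by
  have h : ∀ n, quad (chirp N δ) p n = if n ∈ (Finset.Ico (0 : ℤ) N).filter (fun n =>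
      n + p.1 ∈ Finset.Ico (0 : ℤ) N ∧ n + p.2 ∈ Finset.Ico (0 : ℤ) N ∧
        n + p.1 + p.2 ∈ Finset.Ico (0 : ℤ) N) then phase (-(p.1 * p.2)) δ else 0 := by
    intro n
    simp only [Finset.mem_filter]
    unfold quad chirp
    by_cases h1 : n ∈ Finset.Ico (0 : ℤ) N
    swap; · rw [if_neg h1]; simp only [h1, false_and, if_false, map_zero, zero_mul]
    by_cases h2 : n + p.1 ∈ Finset.Ico (0 : ℤ) N
    swap; · simp only [h2, if_false, false_and, and_false, mul_zero, zero_mul]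
    by_cases h3 : n + p.2 ∈ Finset.Ico (0 : ℤ) N
    swap; · simp only [h3, if_false, false_and, and_false, mul_zero, zero_mul]
    by_cases h4 : n + p.1 + p.2 ∈ Finset.Ico (0 : ℤ) N
    swap; · simp only [h4, if_false, and_false, map_zero, mul_zero]
    rw [if_pos h1, if_pos h2, if_pos h3, if_pos h4, if_pos ⟨h1, h2, h3, h4⟩, ← Complex.exp_conj,
      ← Complex.exp_conj, ← Complex.exp_add, ← Complex.exp_add, ← Complex.exp_add, phase]
    congr 1
    simp only [map_mul, Complex.conj_I, map_pow, Complex.conj_ofReal, map_intCast]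
    push_cast
    ring
  rw [tsum_congr h, tsum_eq_sum (s := (Finset.Ico (0 : ℤ) N).filter (fun n =>
      n + p.1 ∈ Finset.Ico (0 : ℤ) N ∧ n + p.2 ∈ Finset.Ico (0 : ℤ) N ∧
        n + p.1 + p.2 ∈ Finset.Ico (0 : ℤ) N)) (fun n hn => if_neg hn), Finset.sum_ite_mem,
    Finset.inter_self, Finset.sum_const, nsmul_eq_mul, count]

lemma quartic_chirp (B : ℝ) (N : ℕ) (δ : ℝ) :
    (quartic (coeff B) (chirp N δ)).re = ∑ p ∈ Finset.Ioo (-N : ℤ) N ×ˢ Finset.Ioo (-N : ℤ) N,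
      count N p * (coeff B p * phase (-(p.1 * p.2)) δ).re := by
  rw [quartic_eq_tsum (summable_norm_coeff_sq B) (sqSummable_chirp N δ),
    tsum_eq_sum (s := Finset.Ioo (-N : ℤ) N ×ˢ Finset.Ioo (-N : ℤ) N), Complex.re_sum]
  · refine Finset.sum_congr rfl fun p _ => ?_
    rw [tsum_quad_chirp, ← Complex.ofReal_natCast, mul_left_comm, Complex.re_ofReal_mul]
  · intro p hp
    rw [tsum_quad_chirp, count_eq_zero hp]
    simp

/-- The real part of `∫₀^η ∫₀^B e^{2im(t - δ)} dt dδ`, for `m ≠ 0`. -/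
def kernel (B η : ℝ) (m : ℤ) : ℝ :=
  (1 - Real.cos (2 * m * η) + Real.cos (2 * m * (B - η)) - Real.cos (2 * m * B)) / (4 * (m : ℝ) ^ 2)

/-- By the convention `x / 0 = 0`, the axes `jk = 0` drop out of the double series. -/
lemma kernel_zero (B η : ℝ) : kernel B η 0 = 0 := by simp [kernel]

/-- Averaging over `δ` gains a second factor `1/|m|`, which makes the double series absolutely
convergent. -/
lemma abs_kernel_le (B η : ℝ) (m : ℤ) : |kernel B η m| ≤ 1 / (m : ℝ) ^ 2 := by
  rw [kernel, abs_div, abs_of_nonneg (by positivity : (0 : ℝ) ≤ 4 * (m : ℝ) ^ 2)]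
  have h : |1 - Real.cos (2 * m * η) + Real.cos (2 * m * (B - η)) - Real.cos (2 * m * B)| ≤ 4 := by
    have h1 := Real.cos_le_one (2 * m * η)
    have h2 := Real.cos_le_one (2 * m * (B - η))
    have h3 := Real.cos_le_one (2 * m * B)
    have h4 := Real.neg_one_le_cos (2 * m * η)
    have h5 := Real.neg_one_le_cos (2 * m * (B - η))
    have h6 := Real.neg_one_le_cos (2 * m * B)
    rw [abs_le]
    constructor <;> linarith
  calc _ ≤ 4 / (4 * (m : ℝ) ^ 2) := by gcongr
    _ = 1 / (m : ℝ) ^ 2 := by rw [← div_div]; norm_num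

lemma re_osc_mul_osc (B η : ℝ) {m : ℤ} (hm : m ≠ 0) :
    (osc B m * osc η (-m)).re = kernel B η m := by
  have hm' : (m : ℝ) ≠ 0 := by exact_mod_cast hm
  have hmc : (m : ℂ) ≠ 0 := by exact_mod_cast hm
  have h1 : osc B m * osc η (-m) = ((1 / (4 * (m : ℝ) ^ 2) : ℝ) : ℂ) *
      (1 - phase (-m) η + phase m B * phase (-m) η - phase m B) := by
    rw [osc_eq_div B hm, osc_eq_div η (neg_ne_zero.2 hm)]
    push_cast
    rw [div_mul_div_comm]
    have : 2 * Complex.I * m * (2 * Complex.I * -m) = 4 * (m : ℂ) ^ 2 := by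
      linear_combination (-4 * (m : ℂ) ^ 2) * Complex.I_sq
    rw [this]
    ring
  have h2 : phase m B * phase (-m) η = phase m (B - η) := by
    rw [phase, phase, phase, ← Complex.exp_add]
    congr 1
    push_cast
    ring
  rw [h1, h2, Complex.re_ofReal_mul]
  simp only [Complex.add_re, Complex.sub_re, Complex.one_re, re_phase, kernel]
  push_cast
  rw [show 2 * -(m : ℝ) * η = -(2 * m * η) by ring, Real.cos_neg]
  ring

lemma integral_re_coeff_mul_phase (B η : ℝ) (p : ℤ × ℤ) :
    ∫ δ in (0 : ℝ)..η, (coeff B p * phase (-(p.1 * p.2)) δ).re =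
      (if p = 0 then -(B * η) else 0) + kernel B η (p.1 * p.2) := by
  have hint : ∫ δ in (0 : ℝ)..η, (coeff B p * phase (-(p.1 * p.2)) δ).re =
      (coeff B p * osc η (-(p.1 * p.2))).re := by
    rw [osc, ← intervalIntegral.integral_const_mul]
    exact intervalIntegral.intervalIntegral_re
      ((continuous_const.mul (continuous_phase _)).intervalIntegrable _ _)
  rw [hint]
  by_cases h : p = 0
  · subst h
    simp [coeff, osc_zero, kernel_zero]
  · by_cases h' : p.1 * p.2 = 0
    · simp [coeff, h, h', kernel_zero]
    · rw [coeff, if_neg h, if_neg h', if_neg h, zero_add, re_osc_mul_osc B η h']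

lemma summable_kernel (B η : ℝ) : Summable fun p : ℤ × ℤ => kernel B η (p.1 * p.2) := by
  have h1 : Summable fun n : ℤ => 1 / (n : ℝ) ^ 2 := Real.summable_one_div_int_pow.2 one_lt_two
  have h2 := Summable.mul_of_nonneg (f := fun n : ℤ => 1 / (n : ℝ) ^ 2)
    (g := fun n : ℤ => 1 / (n : ℝ) ^ 2) h1 h1 (fun _ => by positivity) (fun _ => by positivity)
  refine Summable.of_norm_bounded h2 fun p => ?_
  rw [Real.norm_eq_abs]
  refine (abs_kernel_le B η _).trans (le_of_eq ?_)
  push_cast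
  field_simp

lemma hasSum_ite_add_kernel (B η : ℝ) : HasSum (fun p : ℤ × ℤ =>
    (if p = 0 then -(B * η) else 0) + kernel B η (p.1 * p.2))
    (-(B * η) + ∑' p : ℤ × ℤ, kernel B η (p.1 * p.2)) :=
  (hasSum_ite_eq 0 (-(B * η))).add (summable_kernel B η).hasSum

/-- Averaging over the chirp, a lower bound for a double cosine series gives positivity. -/
lemma exists_quartic_pos_of_lt_tsum_kernel {B η : ℝ} (hη : 0 ≤ η)
    (h : B * η < ∑' p : ℤ × ℤ, kernel B η (p.1 * p.2)) :
    ∃ a, SqSummable a ∧ 0 < (quartic (coeff B) a).re := by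
  by_contra! hcon
  set q : ℤ × ℤ → ℝ := fun p => (if p = 0 then -(B * η) else 0) + kernel B η (p.1 * p.2) with hq
  have hsum : HasSum q (-(B * η) + ∑' p : ℤ × ℤ, kernel B η (p.1 * p.2)) := hasSum_ite_add_kernel B η
  -- The sum is `1/N` times the average, unnormalized, of the form over the chirps with `δ ∈ [0,
  -- η]`.
  have hN : ∀ N : ℕ, ∑' p, q p * ((count N p : ℝ) / N) ≤ 0 := by
    intro N
    have h1 : ∑' p, q p * ((count N p : ℝ) / N) = (N : ℝ)⁻¹ *
        ∑ p ∈ Finset.Ioo (-N : ℤ) N ×ˢ Finset.Ioo (-N : ℤ) N, count N p * q p := by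
      rw [tsum_eq_sum (s := Finset.Ioo (-N : ℤ) N ×ˢ Finset.Ioo (-N : ℤ) N)
        (fun p hp => by rw [count_eq_zero hp]; simp), Finset.mul_sum]
      exact Finset.sum_congr rfl fun p _ => by ring
    have h2 : ∑ p ∈ Finset.Ioo (-N : ℤ) N ×ˢ Finset.Ioo (-N : ℤ) N, count N p * q p =
        ∫ δ in (0 : ℝ)..η, (quartic (coeff B) (chirp N δ)).re := by
      simp_rw [quartic_chirp]
      rw [intervalIntegral.integral_finsetSum]
      · refine Finset.sum_congr rfl fun p _ => ?_
        rw [intervalIntegral.integral_const_mul, integral_re_coeff_mul_phase]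
      · intro p _
        exact (continuous_const.mul (Complex.continuous_re.comp
          (continuous_const.mul (continuous_phase _)))).intervalIntegrable _ _
    rw [h1, h2]
    refine mul_nonpos_of_nonneg_of_nonpos (by positivity) ?_
    rw [← neg_nonneg, ← intervalIntegral.integral_neg]
    exact intervalIntegral.integral_nonneg hη fun δ _ =>
      neg_nonneg.2 (hcon _ (sqSummable_chirp N δ))
  -- Dominated convergence: `count N p / N` is at most `1` and tends to `1`.
  have hlim : Tendsto (fun N : ℕ => ∑' p, q p * ((count N p : ℝ) / N)) atTop (𝓝 (∑' p, q p)) := by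
    refine tendsto_tsum_of_dominated_convergence hsum.summable.abs (fun p => ?_)
      (Eventually.of_forall fun N p => ?_)
    · simpa using (tendsto_count_div p).const_mul (q p)
    · rw [Real.norm_eq_abs, abs_mul]
      refine mul_le_of_le_one_right (abs_nonneg _) ?_
      rw [abs_of_nonneg (by positivity)]
      exact div_le_one_of_le₀ (by exact_mod_cast count_le N p) (Nat.cast_nonneg _)
  have := le_of_tendsto' hlim hN
  rw [hsum.tsum_eq] at this
  linarith

/-! ### The double cosine series, summed by rows -/

/-- The periodized Bernoulli polynomial `B₂`. -/
def perBernoulli (y : ℝ) : ℝ := Int.fract y ^ 2 - Int.fract y + 1 / 6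

/-- Real part of the Fourier series of `B₂`; the term `k = 0` is zero by the division convention. -/
lemma hasSum_cos_div_sq (y : ℝ) :
    HasSum (fun k : ℤ => Real.cos (2 * Real.pi * k * y) / (k : ℝ) ^ 2)
      (2 * Real.pi ^ 2 * perBernoulli y) := by
  have hx : Int.fract y ∈ Set.Icc (0 : ℝ) 1 := ⟨Int.fract_nonneg y, (Int.fract_lt_one y).le⟩
  have h := Complex.hasSum_re (hasSum_one_div_pow_mul_fourier_mul_bernoulliFun le_rfl hx)
  have e1 : ∀ k : ℤ, (1 / (k : ℂ) ^ 2 * fourier k ((Int.fract y : ℝ) : AddCircle (1 : ℝ))).re =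
      Real.cos (2 * Real.pi * k * y) / (k : ℝ) ^ 2 := by
    intro k
    rw [fourier_coe_apply]
    have : Complex.exp (2 * Real.pi * Complex.I * k * (Int.fract y : ℝ) / (1 : ℝ)) =
        Complex.exp ((2 * Real.pi * k * y - (k * ⌊y⌋ : ℤ) * (2 * Real.pi) : ℝ) * Complex.I) := by
      congr 1
      rw [Int.fract]
      push_cast
      ring
    rw [this, show (1 : ℂ) / (k : ℂ) ^ 2 = ((1 / (k : ℝ) ^ 2 : ℝ) : ℂ) by push_cast; ring,
      Complex.re_ofReal_mul, Complex.exp_ofReal_mul_I_re, Real.cos_sub_int_mul_two_pi]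
    ring
  simp_rw [e1] at h
  convert h using 1
  rw [bernoulliFun_two, perBernoulli]
  have : -(2 * Real.pi * Complex.I) ^ 2 / ((2 : ℕ).factorial : ℂ) *
      ((Int.fract y ^ 2 - Int.fract y + 6⁻¹ : ℝ) : ℂ) =
      ((2 * Real.pi ^ 2 * (Int.fract y ^ 2 - Int.fract y + 6⁻¹) : ℝ) : ℂ) := by
    rw [mul_pow, Complex.I_sq]
    push_cast [Nat.factorial]
    ring
  rw [this, Complex.ofReal_re]
  norm_num

/-- The sum over a row of the double cosine series. -/
def rowSum (B η : ℝ) (j : ℤ) : ℝ :=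
  Real.pi ^ 2 / (2 * (j : ℝ) ^ 2) * (1 / 6 - perBernoulli (j * (η / Real.pi)) +
    perBernoulli (j * ((B - η) / Real.pi)) - perBernoulli (j * (B / Real.pi)))

lemma hasSum_kernel_row (B η : ℝ) (j : ℤ) :
    HasSum (fun k : ℤ => kernel B η (j * k)) (rowSum B η j) := by
  have h0 := hasSum_cos_div_sq 0
  have e0 : perBernoulli 0 = 1 / 6 := by simp [perBernoulli]
  have h1 := hasSum_cos_div_sq (j * (η / Real.pi))
  have h2 := hasSum_cos_div_sq (j * ((B - η) / Real.pi))
  have h3 := hasSum_cos_div_sq (j * (B / Real.pi))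
  have h := (((h0.sub h1).add h2).sub h3).mul_left (1 / (4 * (j : ℝ) ^ 2))
  have hπ := Real.pi_ne_zero
  have harg : ∀ (k : ℤ) (x : ℝ), 2 * Real.pi * k * (j * (x / Real.pi)) = 2 * (j * k : ℤ) * x := by
    intro k x
    push_cast
    field_simp
  simp_rw [harg, e0] at h
  have e1 : (fun k : ℤ => kernel B η (j * k)) = fun k : ℤ => 1 / (4 * (j : ℝ) ^ 2) *
      (Real.cos (2 * Real.pi * k * 0) / (k : ℝ) ^ 2 - Real.cos (2 * (j * k : ℤ) * η) / (k : ℝ) ^ 2 +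
        Real.cos (2 * (j * k : ℤ) * (B - η)) / (k : ℝ) ^ 2 -
        Real.cos (2 * (j * k : ℤ) * B) / (k : ℝ) ^ 2) := by
    ext k
    rw [kernel, mul_zero, Real.cos_zero, ← sub_div, ← add_div, ← sub_div, div_mul_div_comm, one_mul]
    push_cast
    congr 1
    ring
  have e2 : rowSum B η j = 1 / (4 * (j : ℝ) ^ 2) * (2 * Real.pi ^ 2 * (1 / 6) -
      2 * Real.pi ^ 2 * perBernoulli (j * (η / Real.pi)) +
      2 * Real.pi ^ 2 * perBernoulli (j * ((B - η) / Real.pi)) -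
      2 * Real.pi ^ 2 * perBernoulli (j * (B / Real.pi))) := by
    rw [rowSum, ← div_div, ← div_div]
    ring
  rw [e1, e2]
  exact h

lemma hasSum_rowSum (B η : ℝ) : HasSum (rowSum B η) (∑' p : ℤ × ℤ, kernel B η (p.1 * p.2)) :=
  (summable_kernel B η).hasSum.prod_fiberwise fun j => hasSum_kernel_row B η j

lemma kernel_neg (B η : ℝ) (m : ℤ) : kernel B η (-m) = kernel B η m := by
  unfold kernel
  push_cast
  simp only [mul_neg, neg_mul, Real.cos_neg, neg_sq]

lemma rowSum_neg (B η : ℝ) (j : ℤ) : rowSum B η (-j) = rowSum B η j := by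
  have h := hasSum_kernel_row B η (-j)
  simp_rw [neg_mul, kernel_neg] at h
  exact h.unique (hasSum_kernel_row B η j)

/-! ### Choices of the averaging length -/

/-- For `η = B/2` two Bernoulli terms cancel and every row is nonnegative. With `b = B/π`, rows `±1`
alone give `π² b (1 - b)`, which exceeds `B η = π² b²/2` exactly when `b < 2/3`. -/
lemma exists_quartic_pos_of_lt_two_pi_div_three {B : ℝ} (hB : 0 < B) (hB' : B < 2 / 3 * Real.pi) :
    ∃ a, SqSummable a ∧ 0 < (quartic (coeff B) a).re := by
  have hπ := Real.pi_pos
  have hrow : ∀ j, rowSum B (B / 2) j = Real.pi ^ 2 / (2 * (j : ℝ) ^ 2) *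
      (Int.fract (j * (B / Real.pi)) * (1 - Int.fract (j * (B / Real.pi)))) := by
    intro j
    rw [rowSum, sub_half, perBernoulli, perBernoulli]
    ring
  have hnn : ∀ j, 0 ≤ rowSum B (B / 2) j := fun j => by
    rw [hrow]
    have h1 := Int.fract_nonneg (j * (B / Real.pi))
    have h2 := sub_nonneg.2 (Int.fract_lt_one (j * (B / Real.pi))).le
    positivity
  refine exists_quartic_pos_of_lt_tsum_kernel (η := B / 2) (by positivity) ?_
  have hle := sum_le_hasSum {1, -1} (fun j _ => hnn j) (hasSum_rowSum B (B / 2))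
  refine lt_of_lt_of_le ?_ hle
  rw [Finset.sum_pair (by norm_num), rowSum_neg, hrow]
  set b := B / Real.pi with hb
  have hBb : B = b * Real.pi := by rw [hb]; field_simp
  have hb0 : 0 < b := by positivity
  have hb1 : b < 2 / 3 := by rw [hb, div_lt_iff₀ hπ]; exact hB'
  have hf : Int.fract (((1 : ℤ) : ℝ) * b) = b := by
    rw [Int.cast_one, one_mul, Int.fract_eq_self]
    constructor <;> linarith
  rw [hf, hBb]
  push_cast
  have h2 : 0 < Real.pi ^ 2 * (b * (2 / 3 - b)) := by
    have := sub_pos.2 hb1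
    positivity
  nlinarith

/-- This is the row combination for `η = π - B`; the right side makes its nonnegativity visible. -/
lemma perBernoulli_two_mul (y : ℝ) : 1 / 6 - 2 * perBernoulli y + perBernoulli (2 * y) =
    if Int.fract y < 1 / 2 then 2 * Int.fract y ^ 2 else 2 * (1 - Int.fract y) ^ 2 := by
  have h0 := Int.fract_nonneg y
  have h1 := Int.fract_lt_one y
  have h2 : Int.fract (2 * y) = Int.fract (2 * Int.fract y) := by
    have : 2 * y = 2 * Int.fract y + ((2 * ⌊y⌋ : ℤ) : ℝ) := by
      push_cast
      linarith [Int.floor_add_fract y]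
    rw [this, Int.fract_add_intCast]
  unfold perBernoulli
  rw [h2]
  split_ifs with h
  · rw [(Int.fract_eq_self (a := 2 * Int.fract y)).2 ⟨by linarith, by linarith⟩]
    ring
  · push Not at h
    have : Int.fract (2 * Int.fract y) = 2 * Int.fract y - 1 := by
      rw [Int.fract_eq_iff]
      exact ⟨by linarith, by linarith, 1, by push_cast; ring⟩
    rw [this]
    ring

/-- For `η = π - B`, evenness and periodicity of `B₂` reduce each row to values at `jb` and `2jb`,
where `b = B/π`. All rows are nonnegative, and rows `±1, ±2, ±3` suffice. -/
lemma exists_quartic_pos_of_lt_five_pi_div_six {B : ℝ} (hB : Real.pi / 2 ≤ B)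
    (hB' : B < 5 / 6 * Real.pi) : ∃ a, SqSummable a ∧ 0 < (quartic (coeff B) a).re := by
  have hπ := Real.pi_pos
  set b := B / Real.pi with hb
  have hBb : B = b * Real.pi := by rw [hb]; field_simp
  have hb0 : 1 / 2 ≤ b := by rw [hb, le_div_iff₀ hπ]; linarith
  have hb1 : b < 5 / 6 := by rw [hb, div_lt_iff₀ hπ]; exact hB'
  have hrow : ∀ j : ℤ, rowSum B (Real.pi - B) j = Real.pi ^ 2 / (2 * (j : ℝ) ^ 2) *
      if Int.fract (j * b) < 1 / 2 then 2 * Int.fract (j * b) ^ 2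
        else 2 * (1 - Int.fract (j * b)) ^ 2 := by
    intro j
    have e1 : perBernoulli (j * ((Real.pi - B) / Real.pi)) = perBernoulli (j * b) := by
      have h1 : (j : ℝ) * ((Real.pi - B) / Real.pi) = -(j * b) + j := by
        rw [hb]; field_simp; ring
      rw [h1]
      unfold perBernoulli
      rw [Int.fract_add_intCast]
      by_cases hz : Int.fract (j * b) = 0
      · rw [Int.fract_neg_eq_zero.2 hz, hz]
      · rw [Int.fract_neg hz]; ring
    have e2 : perBernoulli (j * ((B - (Real.pi - B)) / Real.pi)) = perBernoulli (2 * (j * b)) := by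
      have h1 : (j : ℝ) * ((B - (Real.pi - B)) / Real.pi) = 2 * (j * b) + ((-j : ℤ) : ℝ) := by
        rw [hb]; push_cast; field_simp; ring
      rw [h1]
      unfold perBernoulli
      rw [Int.fract_add_intCast]
    rw [← perBernoulli_two_mul, rowSum, e1, e2, ← hb]
    ring
  have hnn : ∀ j, 0 ≤ rowSum B (Real.pi - B) j := fun j => by
    rw [hrow]
    split_ifs <;> positivity
  refine exists_quartic_pos_of_lt_tsum_kernel (η := Real.pi - B) (by linarith) ?_
  have hle := sum_le_hasSum {1, -1, 2, -2, 3, -3} (fun j _ => hnn j) (hasSum_rowSum B (Real.pi - B))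
  refine lt_of_lt_of_le ?_ hle
  rw [show ({1, -1, 2, -2, 3, -3} : Finset ℤ).sum (rowSum B (Real.pi - B)) =
    2 * rowSum B (Real.pi - B) 1 + 2 * rowSum B (Real.pi - B) 2 + 2 * rowSum B (Real.pi - B) 3 by
      simp [rowSum_neg]; ring]
  have r1 : rowSum B (Real.pi - B) 1 = Real.pi ^ 2 * (1 - b) ^ 2 := by
    have hf : Int.fract (((1 : ℤ) : ℝ) * b) = b := by
      rw [Int.cast_one, one_mul, Int.fract_eq_self]
      constructor <;> linarith
    rw [hrow, hf, if_neg (by linarith)]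
    push_cast
    ring
  have r2 : rowSum B (Real.pi - B) 2 = Real.pi ^ 2 / 4 *
      if b < 3 / 4 then (2 * b - 1) ^ 2 else (2 - 2 * b) ^ 2 := by
    have hf : Int.fract (((2 : ℤ) : ℝ) * b) = 2 * b - 1 := by
      rw [Int.fract_eq_iff]
      exact ⟨by linarith, by linarith, 1, by push_cast; ring⟩
    rw [hrow, hf]
    by_cases h : b < 3 / 4
    · rw [if_pos (by linarith), if_pos h]
      push_cast
      ring
    · rw [if_neg (by linarith), if_neg h]
      push_cast
      ring
  -- Both branches give the squared distance of `3b` to the integer `2`; the nearest integer stays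
  -- `2` up to `b = 5/6`, the upper limit assumed here.
  have r3 : rowSum B (Real.pi - B) 3 = Real.pi ^ 2 / 9 * (3 * b - 2) ^ 2 := by
    rw [hrow]
    by_cases h : b < 2 / 3
    · have hf : Int.fract (((3 : ℤ) : ℝ) * b) = 3 * b - 1 := by
        rw [Int.fract_eq_iff]
        exact ⟨by linarith, by linarith, 1, by push_cast; ring⟩
      rw [hf, if_neg (by linarith)]
      push_cast
      ring
    · have hf : Int.fract (((3 : ℤ) : ℝ) * b) = 3 * b - 2 := by
        rw [Int.fract_eq_iff]
        exact ⟨by linarith, by linarith, 2, by push_cast; ring⟩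
      rw [hf, if_pos (by linarith)]
      push_cast
      ring
  rw [r1, r2, r3]
  -- Right minus left is a quadratic in `b` with negative discriminant on each branch, with vertex
  -- `29/42` on the first and `5/6` on the second.
  have hgoal : b * (1 - b) < 2 * (1 - b) ^ 2 +
      2 / 4 * (if b < 3 / 4 then (2 * b - 1) ^ 2 else (2 - 2 * b) ^ 2) + 2 / 9 * (3 * b - 2) ^ 2 := by
    split_ifs with h
    · nlinarith [sq_nonneg (b - 29 / 42)]
    · nlinarith [sq_nonneg (b - 5 / 6), sq_nonneg (b - 3 / 4)]
  have hmul := mul_lt_mul_of_pos_left hgoal (sq_pos_of_pos hπ)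
  rw [hBb]
  calc b * Real.pi * (Real.pi - b * Real.pi) = Real.pi ^ 2 * (b * (1 - b)) := by ring
    _ < _ := hmul
    _ = _ := by ring

/-- The ranges overlap on `[π/2, 2π/3)`, and `π > 3.14` gives `5π/6 > 2.6`. -/
lemma exists_quartic_pos {B : ℝ} (hB : 0 < B) (hB' : B < 2.6) :
    ∃ a, SqSummable a ∧ 0 < (quartic (coeff B) a).re := by
  have hπ := Real.pi_gt_d2
  rcases lt_or_ge B (Real.pi / 2) with h | h
  · exact exists_quartic_pos_of_lt_two_pi_div_three hB (by linarith)
  · exact exists_quartic_pos_of_lt_five_pi_div_six h (by norm_num at hB'; linarith)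

/-! ### Existence of maximizers -/

lemma exists_fourierCoeff_eq {a : ℤ → ℂ} (ha : SqSummable a) : ∃ u : L2T, fourierCoeff u = a := by
  have hmem : Memℓp a 2 := by
    rw [memℓp_gen_iff (by norm_num)]
    simpa [SqSummable] using ha
  refine ⟨ofHaar (fourierBasis.repr.symm ⟨a, hmem⟩), ?_⟩
  ext n
  rw [fourierCoeff_ofHaar, ← fourierBasis_repr, LinearIsometryEquiv.apply_symm_apply]

theorem exists_isMaximizer {B : ℝ} (hB : 0 < B) (hB' : B < 2.6) :
    J B 1 < ⊤ ∧ ∃ u₀ : L2T, IsMaximizer B 1 u₀ := by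
  obtain ⟨a, ha, ha1, hmax⟩ :=
    exists_maximizer_quartic (summable_norm_coeff_sq B) (exists_quartic_pos hB hB')
  have hπ := Real.two_pi_pos
  -- Unit `L²` norm for Lebesgue measure means coefficient mass `1/(2π)`, so the unit maximizer is
  -- rescaled by `r`.
  set r : ℝ := √((2 * Real.pi)⁻¹) with hr
  have hr2 : r ^ 2 = (2 * Real.pi)⁻¹ := Real.sq_sqrt (by positivity)
  obtain ⟨u₀, hu₀⟩ := exists_fourierCoeff_eq (ha.smul (r : ℂ))
  have hmass : mass ((r : ℂ) • a) = (2 * Real.pi)⁻¹ := by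
    rw [mass_smul, ha1, Complex.norm_real, Real.norm_eq_abs, sq_abs, hr2, mul_one]
  have hnorm : ‖u₀‖ ^ 2 = 1 := by
    have := (fourierCoeff_sqSummable_and_mass u₀).2
    rw [hu₀, hmass] at this
    exact (mul_eq_left₀ (by positivity)).1 this.symm
  have hle : ∀ u : L2T, ‖u‖ ^ 2 = 1 → W B u ≤ W B u₀ := by
    intro u hu
    obtain ⟨hs, hm⟩ := fourierCoeff_sqSummable_and_mass u
    rw [hu, mul_one] at hm
    have hG := hmax _ hs
    rw [W_eq hB.le, W_eq hB.le, hu₀, hmass, hm, quartic_smul, ← Complex.ofReal_pow,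
      Complex.re_ofReal_mul]
    rw [hm] at hG
    have h4 : r ^ 4 = ((2 * Real.pi)⁻¹) ^ 2 := by rw [← hr2]; ring
    rw [h4, mul_comm (((2 * Real.pi)⁻¹) ^ 2)]
    gcongr
  have hJ : W B u₀ = J B 1 := by
    refine le_antisymm (le_sSup ⟨u₀, hnorm, rfl⟩) (sSup_le ?_)
    rintro _ ⟨u, hu, rfl⟩
    exact hle u hu
  refine ⟨?_, u₀, hnorm, hJ⟩
  rw [← hJ, W_eq hB.le]
  exact ENNReal.ofReal_lt_top

end TorusStrichartz

end

theorem mainTheorem4 :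
    ∃ B₄ : ℝ, |B₄ - 2.60| ≤ 0.01 ∧
      ∀ B : ℝ, 0 < B → B < B₄ →
        TorusStrichartz.J B 1 < ⊤ ∧
          ∃ u₀ : TorusStrichartz.L2T, TorusStrichartz.IsMaximizer B 1 u₀ := by
  exact ⟨2.6, by norm_num, fun B hB hB' => TorusStrichartz.exists_isMaximizer hB hB'⟩
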